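/- Let $d\ge 2$, $T>0$, and let $H(t)$ be a Hermitian-matrix-valued Hamiltonian on $\mathbb{C}^d$, periodic with period $T$ and integrable over a period; finitely many Dirac pulses $K\,\delta(t-\tau)$ per period, with $K$ Hermitian, are allowed. Let $B=\int_0^T\|H(t)\|_\infty\,dt<\infty$, where $\|\cdot\|_\infty$ is the operator norm and each pulse occurring in $(0,T]$ contributes $\|K\|_\infty$. Let $U(t)=\mathcal{T}\exp\left(-i\int_0^tH(s)\,ds\right)$, $t\ge0$, be the unitary evolution operator. For an integer $k\ge1$, say that $H$ satisfies $k$-HSE if for every pure state $\psi=|\psi\rangle\langle\psi|$ on $\mathbb{C}^d$, $$\lim_{S\to\infty}\frac1S\int_0^S\big(U(t)\,\psi\,U(t)^\dagger\big)^{\otimes k}dt=\int_{\mathrm{U}(d)}\big(V\phi_0V^\dagger\big)^{\otimes k}\,dV,$$ where $dV$ is the Haar probability measure on the unitary group and $\phi_0$ is any fixed pure state (the right-hand side does not depend on it); and say that $H$ satisfies $k$-UE if $$\lim_{S\to\infty}\frac1S\int_0^S\big(U(t)^*\otimes U(t)\big)^{\otimes k}dt=\int_{\mathrm{U}(d)}(V^*\otimes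 V)^{\otimes k}\,dV,$$ where $V^*$ is the entrywise complex conjugate. Put $$\gamma=\gamma(k,d)=\sqrt{1-\left(\frac{(d-1)!\,k!}{(d+k-1)!}\right)^{1/k}},\qquad C=2^{5-4d}(d-1)^{2-2d}(2d-3)^{2d-3}.$$ Then for every $k\ge1$: if $H$ satisfies $k$-HSE, then $B\ge C\gamma^{3-2d}$; moreover $$C\gamma^{3-2d}\ \ge\ \frac{8}{(4d)^d}\left(\frac{k}{\log(k+1)}\right)^{d-\frac32}.$$ Consequently $H$ does not exhibit complete Hilbert-space ergodicity ($k$-HSE for all $k\ge1$), and hence does not exhibit complete unitary ergodicity ($k$-UE for all $k\ge1$). -/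

import Mathlib

open scoped Matrix Kronecker Matrix.Norms.L2Operator Topology

/-! Throughout, `Matrix (Fin d) (Fin d) ℂ` carries the operator norm induced by the Euclidean norm
of `ℂᵈ`, i.e. the Schatten `∞`-norm, and `ℏ = 1`. -/

namespace HilbertErgodicity

/-- The unitary group is compact, so that its Haar measure can be normalized. -/
theorem compactSpace_unitaryGroup (d : ℕ) : CompactSpace (Matrix.unitaryGroup (Fin d) ℂ) := by
  refine isCompact_iff_compactSpace.mp ?_
  have : ProperSpace (Matrix (Fin d) (Fin d) ℂ) := FiniteDimensional.proper ℂ _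
  refine Metric.isCompact_of_isClosed_isBounded isClosed_unitary ?_
  refine (Metric.isBounded_closedBall (x := (0 : Matrix (Fin d) (Fin d) ℂ)) (r := 1)).subset ?_
  intro V hV
  rw [mem_closedBall_zero_iff]
  have h := CStarRing.norm_star_mul_self (x := V)
  rw [(Unitary.mem_iff.mp hV).1] at h
  have h1 : ‖(1 : Matrix (Fin d) (Fin d) ℂ)‖ ≤ 1 := by
    have h2 := CStarRing.norm_star_mul_self (x := (1 : Matrix (Fin d) (Fin d) ℂ))
    simp only [star_one, mul_one] at h2
    nlinarith [norm_nonneg (1 : Matrix (Fin d) (Fin d) ℂ)]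
  nlinarith [norm_nonneg V]

/-- The expectation `∫ f(V) dV` over the Haar probability measure of the unitary group `U(d)`. -/
noncomputable def haarAverage {d : ℕ} {E : Type*} [NormedAddCommGroup E] [NormedSpace ℝ E]
    (f : Matrix.unitaryGroup (Fin d) ℂ → E) : E :=
  letI : MeasurableSpace (Matrix.unitaryGroup (Fin d) ℂ) := borel _
  haveI : BorelSpace (Matrix.unitaryGroup (Fin d) ℂ) := ⟨rfl⟩
  haveI : CompactSpace (Matrix.unitaryGroup (Fin d) ℂ) := compactSpace_unitaryGroup d
  ∫ V, f V ∂(MeasureTheory.Measure.haarMeasure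
    (⊤ : TopologicalSpace.PositiveCompacts (Matrix.unitaryGroup (Fin d) ℂ)))

/-- The `k`-fold tensor power `A^{⊗k}`, as a matrix indexed by multi-indices. -/
def tensorPow {ι : Type*} (k : ℕ) (A : Matrix ι ι ℂ) : Matrix (Fin k → ι) (Fin k → ι) ℂ :=
  Matrix.of fun a b => ∏ i, A (a i) (b i)

/-- The density matrix `|ψ⟩⟨ψ|`. -/
def density {d : ℕ} (ψ : EuclideanSpace ℂ (Fin d)) : Matrix (Fin d) (Fin d) ℂ :=
  Matrix.of fun a b => ψ a * star (ψ b)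

/-- `(V |ψ⟩⟨ψ| V†)^{⊗k}`: `k` replicas of the state `ψ` rotated by `V`. -/
noncomputable def stateMoment {d : ℕ} (k : ℕ) (ψ : EuclideanSpace ℂ (Fin d))
    (V : Matrix.unitaryGroup (Fin d) ℂ) : Matrix (Fin k → Fin d) (Fin k → Fin d) ℂ :=
  tensorPow k ((V : Matrix (Fin d) (Fin d) ℂ) * density ψ * (V : Matrix (Fin d) (Fin d) ℂ)ᴴ)

/-- `V^{⊗k,k} = (V* ⊗ V)^{⊗k}`, where `V*` is the entrywise complex conjugate. -/
noncomputable def unitaryMoment {d : ℕ} (k : ℕ) (V : Matrix.unitaryGroup (Fin d) ℂ) :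
    Matrix (Fin k → Fin d × Fin d) (Fin k → Fin d × Fin d) ℂ :=
  tensorPow k ((V : Matrix (Fin d) (Fin d) ℂ).map star ⊗ₖ (V : Matrix (Fin d) (Fin d) ℂ))

/-- `f` has infinite-time average `m`: `lim_{S → ∞} (1/S) ∫₀^S f(t) dt = m`. -/
def HasTimeAverage {E : Type*} [NormedAddCommGroup E] [NormedSpace ℝ E] (f : ℝ → E) (m : E) :
    Prop :=
  Filter.Tendsto (fun S : ℝ => S⁻¹ • ∫ t in (0 : ℝ)..S, f t) Filter.atTop (𝓝 m)

/-- Hilbert-space `k`-ergodicity (`k`-HSE) of the evolution `U`: for every initial pure state, the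
`k`-th moment of its temporal ensemble exists and equals the `k`-th moment of the Haar ensemble of
pure states.  The Haar moment `∫ (V φ₀ V†)^{⊗k} dV` does not depend on the reference pure state
`φ₀`, by invariance of the Haar measure; the initial state serves as reference. -/
def IsHSE {d : ℕ} (U : ℝ → Matrix.unitaryGroup (Fin d) ℂ) (k : ℕ) : Prop :=
  ∀ ψ : EuclideanSpace ℂ (Fin d), ‖ψ‖ = 1 →
    HasTimeAverage (fun t => stateMoment k ψ (U t)) (haarAverage (stateMoment k ψ))

/-- Complete Hilbert-space ergodicity: `k`-HSE for all `k`. -/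
def IsCHSE {d : ℕ} (U : ℝ → Matrix.unitaryGroup (Fin d) ℂ) : Prop :=
  ∀ k : ℕ, 1 ≤ k → IsHSE U k

/-- Unitary `k`-ergodicity (`k`-UE). -/
def IsUE {d : ℕ} (U : ℝ → Matrix.unitaryGroup (Fin d) ℂ) (k : ℕ) : Prop :=
  HasTimeAverage (fun t => unitaryMoment k (U t)) (haarAverage (unitaryMoment (d := d) k))

/-- Complete unitary ergodicity: `k`-UE for all `k`. -/
def IsCUE {d : ℕ} (U : ℝ → Matrix.unitaryGroup (Fin d) ℂ) : Prop :=
  ∀ k : ℕ, 1 ≤ k → IsUE U k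

/-- A time-periodic Hamiltonian on `ℂᵈ` with period `T` and finite strength.  It may contain
`δ`-pulses: formally it is `H(t) = reg t + ∑_τ δ(t - τ) kick τ`, where `reg` is integrable over a
period and there are finitely many pulses in a period.  Without pulses, `kick = 0`. -/
structure PeriodicHamiltonian (d : ℕ) (T : ℝ) where
  /-- the regular part -/
  reg : ℝ → Matrix (Fin d) (Fin d) ℂ
  /-- the weight of the `δ`-pulse at a given time (zero if there is no pulse at that time) -/
  kick : ℝ → Matrix (Fin d) (Fin d) ℂ
  reg_isHermitian : ∀ t, (reg t).IsHermitian
  kick_isHermitian : ∀ t, (kick t).IsHermitian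
  reg_periodic : Function.Periodic reg T
  kick_periodic : Function.Periodic kick T
  reg_integrable : IntervalIntegrable reg MeasureTheory.volume 0 T
  kick_finite : {t | t ∈ Set.Ioc 0 T ∧ kick t ≠ 0}.Finite

namespace PeriodicHamiltonian

variable {d : ℕ} {T : ℝ}

/-- The strength `B = ∫₀ᵀ ‖H(t)‖_∞ dt`; a pulse `δ(t - τ) K` contributes `‖K‖_∞`. -/
noncomputable def strength (H : PeriodicHamiltonian d T) : ℝ :=
  (∫ t in (0 : ℝ)..T, ‖H.reg t‖) + ∑ᶠ t ∈ Set.Ioc 0 T, ‖H.kick t‖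

/-- `U(t)`, `t ≥ 0`, is the unitary evolution operator `𝒯 exp(-i ∫₀ᵗ H)`, right-continuous at the
pulses: `U(0) = 1`; Schrödinger's equation `i ∂ₜU = H U` holds, in integrated form, on every time
interval `(s, t]` without pulses; at each `t > 0`, `U(t) = exp(-i K) U(t⁻)` where `K` is the weight
of the pulse at `t`. -/
structure IsPropagator (H : PeriodicHamiltonian d T) (U : ℝ → Matrix.unitaryGroup (Fin d) ℂ) :
    Prop where
  initial : U 0 = 1
  integrable : ∀ s t : ℝ, 0 ≤ s → s ≤ t →
    IntervalIntegrable (fun r => H.reg r * (U r : Matrix (Fin d) (Fin d) ℂ))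
      MeasureTheory.volume s t
  schrodinger : ∀ s t : ℝ, 0 ≤ s → s ≤ t → (∀ r ∈ Set.Ioc s t, H.kick r = 0) →
    (U t : Matrix (Fin d) (Fin d) ℂ) =
      U s - Complex.I • ∫ r in s..t, H.reg r * (U r : Matrix (Fin d) (Fin d) ℂ)
  pulse : ∀ t : ℝ, 0 < t →
    Filter.Tendsto
      (fun s => NormedSpace.exp (-(Complex.I • H.kick t)) * (U s : Matrix (Fin d) (Fin d) ℂ))
      (𝓝[<] t) (𝓝 (U t : Matrix (Fin d) (Fin d) ℂ))

end PeriodicHamiltonian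

/-- The radius `γ(k, d) = √(1 - ((d-1)! k! / (d+k-1)!)^{1/k})` for which the support of a state
`k`-design is a `γ`-net in trace distance. -/
noncomputable def netRadius (k d : ℕ) : ℝ :=
  Real.sqrt (1 - (((d - 1).factorial * k.factorial : ℝ) / (d + k - 1).factorial) ^ (1 / (k : ℝ)))

/-- The constant `C = 2^{5-4d} (d-1)^{2-2d} (2d-3)^{2d-3}`. -/
noncomputable def boundConst (d : ℕ) : ℝ :=
  (2 : ℝ) ^ (5 - 4 * (d : ℝ)) * ((d : ℝ) - 1) ^ (2 - 2 * (d : ℝ)) *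
    (2 * (d : ℝ) - 3) ^ (2 * (d : ℝ) - 3)

end HilbertErgodicity

/-! Let `ψ` be an eigenvector of the Floquet operator `U T`. By Floquet's theorem `U (t + T) = U t *
U T`, its orbit closes up after one period, up to a phase. In operator norm `U` moves by at most the
strength spent, so this closed curve of states has length at most `B`. Ergodicity forces the curve
to come close to every state, and a short curve cannot do so.

Closeness: pairing the `k`-th moment with a product functional turns `k`-HSE (and equally `k`-UE)
into a statement about the time average of `|⟨φ|U(t)|ψ⟩|^{2k}`. That average is the Haar value
`(d-1)! k! / (d+k-1)!`, computed from Gaussian integrals, so no uniform bound in `t` can be smaller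
(`OrbitMomentBound`). Taking `k`-th roots, the orbit comes within trace distance `γ + ε` of every
`φ`, for all `ε > 0`.

Counting: cutting the orbit into pieces of strength `δ` gives a net of radius `γ + δ` with at most
`⌊B/δ⌋ + 1` points. A ball of radius `r` in trace distance occupies at most the fraction
`r^{2(d-1)}` of the state space, hence `1 ≤ (⌊B/δ⌋ + 1) (γ + δ)^{2(d-1)}` for all `δ > 0`. A nearly
optimal `δ` gives `B ≥ C γ^{3-2d}` (`boundConst_mul_rpow_le_of_net`).

Growth: the Haar value is the inverse of a binomial coefficient and at least `(k+1)^{-(d-1)}`, so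
`γ² ≤ (d-1) log(k+1) / k`. The bound therefore diverges with `k`, and no finite `B` satisfies it for
every `k`. Throughout, `n = d - 1`. -/

namespace HilbertErgodicity

/-! ### Gaussian integrals and the volume of balls in trace distance. -/

section Gaussian
open MeasureTheory Module

/-- Every unit vector is a member of an orthonormal basis. -/
theorem exists_orthonormalBasis_apply_eq {F : Type*} [NormedAddCommGroup F]
    [InnerProductSpace ℂ F] [FiniteDimensional ℂ F] {m : ℕ} (hF : finrank ℂ F = m) (i : Fin m)
    {v : F} (hv : ‖v‖ = 1) : ∃ b : OrthonormalBasis (Fin m) ℂ F, b i = v := by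
  obtain ⟨b, hb⟩ := Orthonormal.exists_orthonormalBasis_extension_of_card_eq (𝕜 := ℂ)
    (ι := Fin m) (by simpa using hF) (v := fun _ => v) (s := {i})
    ⟨fun _ => hv, fun i j hij => (hij (Subsingleton.elim i j)).elim⟩
  exact ⟨b, hb _ rfl⟩

/-- Two finite-dimensional complex inner product spaces of equal dimension are related by an
isometry taking a given unit vector to a given unit vector. -/
theorem exists_linearIsometryEquiv_apply_eq {A E : Type*} [NormedAddCommGroup A]
    [InnerProductSpace ℂ A] [FiniteDimensional ℂ A] [NormedAddCommGroup E] [InnerProductSpace ℂ E]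
    [FiniteDimensional ℂ E] (h : finrank ℂ A = finrank ℂ E) {a : A} {u : E} (ha : ‖a‖ = 1)
    (hu : ‖u‖ = 1) : ∃ L : A ≃ₗᵢ[ℂ] E, L a = u := by
  have hpos : 0 < finrank ℂ A := by
    have : Nontrivial A := ⟨a, 0, by rintro rfl; simp at ha⟩
    exact finrank_pos
  obtain ⟨b, hb⟩ := exists_orthonormalBasis_apply_eq rfl ⟨0, hpos⟩ ha
  obtain ⟨c, hc⟩ := exists_orthonormalBasis_apply_eq h.symm ⟨0, hpos⟩ hu
  refine ⟨b.repr.trans c.repr.symm, ?_⟩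
  rw [LinearIsometryEquiv.trans_apply, ← hb, ← hc, OrthonormalBasis.repr_self,
    OrthonormalBasis.repr_symm_single]

theorem finrank_real_euclideanSpace_complex (n : ℕ) :
    finrank ℝ (EuclideanSpace ℂ (Fin n)) = 2 * n := by
  rw [← finrank_mul_finrank ℝ ℂ, Complex.finrank_real_complex, finrank_euclideanSpace_fin]

theorem integral_exp_neg_norm_sq (n : ℕ) :
    ∫ x : EuclideanSpace ℂ (Fin n), Real.exp (-‖x‖ ^ 2) = Real.pi ^ n := by
  have h := GaussianFourier.integral_rexp_neg_mul_sq_norm (V := EuclideanSpace ℂ (Fin n))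
    (b := 1) one_pos
  rw [finrank_real_euclideanSpace_complex] at h
  simpa using h

theorem integral_exp_neg_mul_norm_sq (n : ℕ) {b : ℝ} (hb : 0 < b) :
    ∫ x : EuclideanSpace ℂ (Fin n), Real.exp (-b * ‖x‖ ^ 2) = (Real.pi / b) ^ n := by
  have h := GaussianFourier.integral_rexp_neg_mul_sq_norm (V := EuclideanSpace ℂ (Fin n)) hb
  rw [finrank_real_euclideanSpace_complex] at h
  simpa using h

theorem integral_Ioi_pow_mul_exp_neg_sq (m : ℕ) :
    ∫ y in Set.Ioi (0 : ℝ), y ^ (2 * m + 1) * Real.exp (-y ^ 2) = m.factorial / 2 := by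
  have h := integral_rpow_mul_exp_neg_rpow (p := 2) (q := 2 * m + 1) two_pos (by
    have : (0 : ℝ) ≤ m := m.cast_nonneg
    linarith)
  rw [show (2 * (m : ℝ) + 1 + 1) / 2 = m + 1 by ring, Real.Gamma_nat_eq_factorial] at h
  rw [← show 1 / 2 * (m.factorial : ℝ) = m.factorial / 2 by ring, ← h]
  refine setIntegral_congr_fun measurableSet_Ioi fun y hy => ?_
  have : (2 * (m : ℝ) + 1) = ((2 * m + 1 : ℕ) : ℝ) := by push_cast; ring
  simp only [this, Real.rpow_natCast]
  norm_num

/-- In polar coordinates both integrals carry the same sphere factor. What remains is the ratio of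
two radial Gamma integrals, so no sphere area is needed. -/
theorem integral_norm_pow_mul_exp_neg_norm_sq {E : Type*} [NormedAddCommGroup E]
    [NormedSpace ℝ E] [FiniteDimensional ℝ E] [MeasurableSpace E] [BorelSpace E] (μ : Measure E)
    [μ.IsAddHaarMeasure] {n : ℕ} (hE : finrank ℝ E = 2 * (n + 1)) (k : ℕ) :
    (∫ x, ‖x‖ ^ (2 * k) * Real.exp (-‖x‖ ^ 2) ∂μ) * n.factorial =
      (n + k).factorial * ∫ x, Real.exp (-‖x‖ ^ 2) ∂μ := by
  have : Nontrivial E := nontrivial_of_finrank_pos (R := ℝ) (by omega)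
  have h1 := integral_fun_norm_addHaar μ fun y => y ^ (2 * k) * Real.exp (-y ^ 2)
  have h2 := integral_fun_norm_addHaar μ fun y => Real.exp (-y ^ 2)
  rw [h1, h2, hE]
  have e1 : ∀ y : ℝ, y ^ (2 * (n + 1) - 1) • (y ^ (2 * k) * Real.exp (-y ^ 2)) =
      y ^ (2 * (n + k) + 1) * Real.exp (-y ^ 2) := fun y => by
    rw [smul_eq_mul, ← mul_assoc, ← pow_add]; congr 2; omega
  have e2 : ∀ y : ℝ, y ^ (2 * (n + 1) - 1) • Real.exp (-y ^ 2) =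
      y ^ (2 * n + 1) * Real.exp (-y ^ 2) := fun y => by
    rw [smul_eq_mul]; congr 2
  simp_rw [e1, e2, integral_Ioi_pow_mul_exp_neg_sq]
  simp only [smul_eq_mul, nsmul_eq_mul]
  ring

theorem integral_complex_exp_neg_norm_sq : ∫ z : ℂ, Real.exp (-‖z‖ ^ 2) = Real.pi := by
  have h := GaussianFourier.integral_rexp_neg_mul_sq_norm (V := ℂ) (b := 1) one_pos
  simpa using h

theorem integral_complex_norm_pow_mul_exp_neg_norm_sq (k : ℕ) :
    ∫ z : ℂ, ‖z‖ ^ (2 * k) * Real.exp (-‖z‖ ^ 2) = k.factorial * Real.pi := by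
  have h := integral_norm_pow_mul_exp_neg_norm_sq (volume : Measure ℂ) (n := 0)
    (by simp) k
  simpa [integral_complex_exp_neg_norm_sq] using h

/-- Splitting off the complex line spanned by a unit vector. -/
theorem exists_measurePreserving_prod {n : ℕ} {u : EuclideanSpace ℂ (Fin (n + 1))}
    (hu : ‖u‖ = 1) :
    ∃ Φ : ℂ × EuclideanSpace ℂ (Fin n) ≃ᵐ EuclideanSpace ℂ (Fin (n + 1)),
      MeasurePreserving Φ volume volume ∧ (∀ p, ‖Φ p‖ ^ 2 = ‖p.1‖ ^ 2 + ‖p.2‖ ^ 2) ∧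
      ∀ p, inner ℂ u (Φ p) = p.1 := by
  let A := WithLp 2 (ℂ × EuclideanSpace ℂ (Fin n))
  have hA : finrank ℂ A = finrank ℂ (EuclideanSpace ℂ (Fin (n + 1))) := by
    rw [(WithLp.linearEquiv 2 ℂ (ℂ × EuclideanSpace ℂ (Fin n))).finrank_eq]
    simp [add_comm]
  let a : A := WithLp.toLp 2 (1, 0)
  have ha : ‖a‖ = 1 := by
    rw [← sq_eq_sq₀ (norm_nonneg _) zero_le_one, WithLp.prod_norm_sq_eq_of_L2]
    simp [a]
  obtain ⟨L, hL⟩ := exists_linearIsometryEquiv_apply_eq hA ha hu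
  let L' : A ≃ₗᵢ[ℝ] EuclideanSpace ℂ (Fin (n + 1)) :=
    { L.toLinearEquiv.restrictScalars ℝ with norm_map' := L.norm_map }
  refine ⟨(MeasurableEquiv.toLp 2 _).trans L'.toMeasurableEquiv,
    (WithLp.volume_preserving_toLp ℂ (EuclideanSpace ℂ (Fin n))).trans
      (LinearIsometryEquiv.measurePreserving L'), fun p => ?_, fun p => ?_⟩
  · change ‖L (WithLp.toLp 2 p)‖ ^ 2 = _
    rw [L.norm_map, WithLp.prod_norm_sq_eq_of_L2]
    rfl
  · change inner ℂ u (L (WithLp.toLp 2 p)) = _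
    rw [← hL, L.inner_map_map, WithLp.prod_inner_apply]
    simp [a]

theorem integral_norm_inner_pow_mul_exp_neg_norm_sq {n : ℕ} {u : EuclideanSpace ℂ (Fin (n + 1))}
    (hu : ‖u‖ = 1) (k : ℕ) :
    ∫ x, ‖(inner ℂ u x : ℂ)‖ ^ (2 * k) * Real.exp (-‖x‖ ^ 2) = k.factorial * Real.pi ^ (n + 1) := by
  obtain ⟨Φ, hΦ, hn, hi⟩ := exists_measurePreserving_prod hu
  rw [← hΦ.integral_comp Φ.measurableEmbedding]
  simp_rw [hn, hi, neg_add, Real.exp_add, ← mul_assoc]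
  rw [Measure.volume_eq_prod, integral_prod_mul (fun z : ℂ => ‖z‖ ^ (2 * k) * Real.exp (-‖z‖ ^ 2))
    (fun y : EuclideanSpace ℂ (Fin n) => Real.exp (-‖y‖ ^ 2)),
    integral_complex_norm_pow_mul_exp_neg_norm_sq, integral_exp_neg_norm_sq]
  ring

/-- The integral of a non-integrable function is `0` by convention, so a nonzero value already
proves integrability. -/
theorem integrable_exp_neg_norm_sq (n : ℕ) :
    Integrable fun x : EuclideanSpace ℂ (Fin n) => Real.exp (-‖x‖ ^ 2) :=
  not_imp_comm.mp integral_undef (by rw [integral_exp_neg_norm_sq]; positivity)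

theorem integrable_exp_neg_mul_norm_sq (n : ℕ) {b : ℝ} (hb : 0 < b) :
    Integrable fun x : EuclideanSpace ℂ (Fin n) => Real.exp (-b * ‖x‖ ^ 2) :=
  not_imp_comm.mp integral_undef (by rw [integral_exp_neg_mul_norm_sq n hb]; positivity)

/-- In the plane the radial density `y * exp (-y ^ 2)` has an elementary antiderivative, which makes
the tail exactly exponential in `s`. -/
theorem setLIntegral_exp_neg_norm_sq_complex {s : ℝ} (hs : 0 ≤ s) :
    ∫⁻ z in {z : ℂ | s ≤ ‖z‖ ^ 2}, ENNReal.ofReal (Real.exp (-‖z‖ ^ 2)) =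
      ENNReal.ofReal (Real.pi * Real.exp (-s)) := by
  have hm : MeasurableSet {z : ℂ | s ≤ ‖z‖ ^ 2} := measurableSet_le (by fun_prop) (by fun_prop)
  have hint : Integrable fun z : ℂ => Real.exp (-‖z‖ ^ 2) :=
    not_imp_comm.mp integral_undef (by rw [integral_complex_exp_neg_norm_sq]; positivity)
  rw [← ofReal_integral_eq_lintegral_ofReal hint.integrableOn
    (Filter.Eventually.of_forall fun _ => (Real.exp_pos _).le), ← integral_indicator hm]
  congr 1
  let f : ℝ → ℝ := fun y => if s ≤ y ^ 2 then Real.exp (-y ^ 2) else 0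
  have h := integral_fun_norm_addHaar (volume : Measure ℂ) f
  have h0 : ∀ z : ℂ, Set.indicator {z : ℂ | s ≤ ‖z‖ ^ 2} (fun z => Real.exp (-‖z‖ ^ 2)) z
      = f ‖z‖ := fun z => by simp [Set.indicator_apply, f]
  simp_rw [h0]
  rw [h, Complex.finrank_real_complex]
  have hd : ∀ y : ℝ, HasDerivAt (fun y => -(Real.exp (-y ^ 2) / 2)) (y * Real.exp (-y ^ 2)) y := by
    intro y
    have h1 := (((hasDerivAt_pow 2 y).neg.exp).div_const 2).neg
    convert! h1 using 1
    push_cast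
    simp
    ring
  have ht : Filter.Tendsto (fun y : ℝ => -(Real.exp (-y ^ 2) / 2)) Filter.atTop (𝓝 0) := by
    have h1 : Filter.Tendsto (fun y : ℝ => Real.exp (-y ^ 2)) Filter.atTop (𝓝 0) :=
      Real.tendsto_exp_neg_atTop_nhds_zero.comp (Filter.tendsto_pow_atTop two_ne_zero)
    simpa using (h1.div_const 2).neg
  have h3 : ∫ y in Set.Ioi (0 : ℝ), y ^ (2 - 1) • f y = Real.exp (-s) / 2 := by
    have h4 := integral_Ioi_of_hasDerivAt_of_nonneg' (a := √s) (fun y _ => hd y)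
      (fun y hy => mul_nonneg ((Real.sqrt_nonneg s).trans (le_of_lt hy)) (Real.exp_pos _).le) ht
    rw [Real.sq_sqrt hs, zero_sub, neg_neg] at h4
    rw [← h4, ← integral_Ici_eq_integral_Ioi (x := √s), ← integral_indicator measurableSet_Ici,
      ← integral_indicator measurableSet_Ioi]
    refine integral_congr_ae ?_
    -- For `s = 0` the two indicators disagree at the single point `0`.
    filter_upwards [Measure.ae_ne volume 0] with y hy0
    have hpos : y ∈ Set.Ici √s ↔ (0 ≤ y ∧ s ≤ y ^ 2) := by
      rw [Set.mem_Ici, Real.sqrt_le_iff]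
    by_cases hy : 0 < y
    · by_cases hys : s ≤ y ^ 2
      · rw [Set.indicator_of_mem (show y ∈ Set.Ioi 0 from hy),
          Set.indicator_of_mem (hpos.2 ⟨hy.le, hys⟩)]
        simp [f, hys]
      · rw [Set.indicator_of_mem (show y ∈ Set.Ioi 0 from hy),
          Set.indicator_of_notMem fun hh => hys (hpos.1 hh).2]
        simp [f, hys]
    · rw [Set.indicator_of_notMem (show y ∉ Set.Ioi 0 from hy), Set.indicator_of_notMem]
      exact fun hh => hy (lt_of_le_of_ne (hpos.1 hh).1 (Ne.symm hy0))
  rw [h3]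
  simp [Measure.real, Complex.volume_ball]
  ring

/-- The Gaussian measure of the cone over a ball in trace distance. -/
theorem setLIntegral_cone_le {n : ℕ} {u : EuclideanSpace ℂ (Fin (n + 1))} (hu : ‖u‖ = 1)
    {r : ℝ} (hr : 0 < r) :
    ∫⁻ x in {x | (1 - r ^ 2) * ‖x‖ ^ 2 ≤ ‖(inner ℂ u x : ℂ)‖ ^ 2},
      ENNReal.ofReal (Real.exp (-‖x‖ ^ 2)) ≤ ENNReal.ofReal (Real.pi ^ (n + 1) * r ^ (2 * n)) := by
  -- For `r ≥ 1` the total Gaussian mass is already small enough; otherwise `1 - r ^ 2` is positive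
  -- and the cone is a genuine restriction.
  rcases le_or_gt 1 r with h1 | h1
  · refine (setLIntegral_le_lintegral _ _).trans ?_
    rw [← ofReal_integral_eq_lintegral_ofReal (integrable_exp_neg_norm_sq _)
      (Filter.Eventually.of_forall fun _ => (Real.exp_pos _).le), integral_exp_neg_norm_sq]
    refine ENNReal.ofReal_le_ofReal ?_
    exact le_mul_of_one_le_right (by positivity) (one_le_pow₀ h1)
  obtain ⟨Φ, hΦ, hn, hi⟩ := exists_measurePreserving_prod hu
  -- With `x = (z, y)` split along `u`, the cone reads `q ‖y‖² ≤ ‖z‖²`. Integrating out `z` leaves a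
  -- Gaussian in `y` with exponent `1 + q = r⁻²`, whence the factor `r ^ (2 * n)`.
  set q : ℝ := (1 - r ^ 2) / r ^ 2 with hq
  have hq0 : 0 ≤ q := div_nonneg (by nlinarith) (by positivity)
  have hm : MeasurableSet
      {x | (1 - r ^ 2) * ‖x‖ ^ 2 ≤ ‖(inner ℂ u x : ℂ)‖ ^ 2} :=
    measurableSet_le (by fun_prop) (by fun_prop)
  rw [← hΦ.setLIntegral_comp_preimage_emb Φ.measurableEmbedding]
  have hset : Φ ⁻¹' {x | (1 - r ^ 2) * ‖x‖ ^ 2 ≤ ‖(inner ℂ u x : ℂ)‖ ^ 2} =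
      {p | q * ‖p.2‖ ^ 2 ≤ ‖p.1‖ ^ 2} := by
    ext p
    simp only [Set.mem_preimage, Set.mem_ofPred_eq, hn, hi, hq]
    rw [div_mul_eq_mul_div, div_le_iff₀ (by positivity)]
    constructor <;> intro h <;> nlinarith
  have hm' : MeasurableSet {p : ℂ × EuclideanSpace ℂ (Fin n) | q * ‖p.2‖ ^ 2 ≤ ‖p.1‖ ^ 2} :=
    measurableSet_le (by fun_prop) (by fun_prop)
  rw [hset, ← lintegral_indicator hm']
  simp_rw [hn]
  rw [Measure.volume_eq_prod, lintegral_prod_symm _ (by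
    refine Measurable.aemeasurable (Measurable.indicator ?_ hm')
    fun_prop)]
  have hy : ∀ y : EuclideanSpace ℂ (Fin n),
      ∫⁻ z : ℂ, Set.indicator {p : ℂ × EuclideanSpace ℂ (Fin n) | q * ‖p.2‖ ^ 2 ≤ ‖p.1‖ ^ 2}
        (fun p => ENNReal.ofReal (Real.exp (-(‖p.1‖ ^ 2 + ‖p.2‖ ^ 2)))) (z, y) =
      ENNReal.ofReal (Real.pi * Real.exp (-(1 + q) * ‖y‖ ^ 2)) := by
    intro y
    have hmz : MeasurableSet {z : ℂ | q * ‖y‖ ^ 2 ≤ ‖z‖ ^ 2} :=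
      measurableSet_le (by fun_prop) (by fun_prop)
    have h2 : ∀ z : ℂ,
        Set.indicator {p : ℂ × EuclideanSpace ℂ (Fin n) | q * ‖p.2‖ ^ 2 ≤ ‖p.1‖ ^ 2}
          (fun p => ENNReal.ofReal (Real.exp (-(‖p.1‖ ^ 2 + ‖p.2‖ ^ 2)))) (z, y) =
        ENNReal.ofReal (Real.exp (-‖y‖ ^ 2)) * Set.indicator {z : ℂ | q * ‖y‖ ^ 2 ≤ ‖z‖ ^ 2}
          (fun z => ENNReal.ofReal (Real.exp (-‖z‖ ^ 2))) z := by
      intro z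
      simp only [Set.indicator_apply, Set.mem_ofPred_eq]
      split_ifs
      · rw [← ENNReal.ofReal_mul (Real.exp_pos _).le, ← Real.exp_add]
        congr 2; ring
      · simp
    simp_rw [h2]
    rw [lintegral_const_mul _ (Measurable.indicator (by fun_prop) hmz), lintegral_indicator hmz,
      setLIntegral_exp_neg_norm_sq_complex (by positivity),
      ← ENNReal.ofReal_mul (Real.exp_pos _).le, mul_left_comm, ← Real.exp_add]
    congr 3; ring
  simp_rw [hy]
  rw [← ofReal_integral_eq_lintegral_ofReal
    ((integrable_exp_neg_mul_norm_sq n (by positivity)).const_mul _)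
    (Filter.Eventually.of_forall fun _ => mul_nonneg Real.pi_pos.le (Real.exp_pos _).le),
    integral_const_mul, integral_exp_neg_mul_norm_sq n (by positivity)]
  refine ENNReal.ofReal_le_ofReal (le_of_eq ?_)
  have : Real.pi / (1 + q) = Real.pi * r ^ 2 := by
    rw [hq]; field_simp; ring
  rw [this, mul_pow, ← pow_mul, pow_succ]; ring

/-- A finite net of radius `r` in trace distance in `ℂⁿ⁺¹` has at least `r⁻²ⁿ` points. -/
theorem one_le_card_mul_pow_of_net {n : ℕ} {ι : Type*} (s : Finset ι)
    (w : ι → EuclideanSpace ℂ (Fin (n + 1))) (hw : ∀ i ∈ s, ‖w i‖ = 1) {r : ℝ} (hr : 0 < r)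
    (hnet : ∀ x, ‖x‖ = 1 → ∃ i ∈ s, 1 - r ^ 2 ≤ ‖(inner ℂ (w i) x : ℂ)‖ ^ 2) :
    1 ≤ s.card * r ^ (2 * n) := by
  set K : ι → Set (EuclideanSpace ℂ (Fin (n + 1))) := fun i =>
    {x | (1 - r ^ 2) * ‖x‖ ^ 2 ≤ ‖(inner ℂ (w i) x : ℂ)‖ ^ 2} with hK
  have hcov : (⋃ i ∈ s, K i) = Set.univ := by
    rw [Set.eq_univ_iff_forall]
    intro x
    simp only [Set.mem_iUnion, exists_prop]
    -- The origin lies in every cone; the net condition at any unit vector shows that there is at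
    -- least one.
    rcases eq_or_ne x 0 with rfl | hx
    · obtain ⟨i, hi, -⟩ := hnet (EuclideanSpace.single 0 1) (by simp)
      exact ⟨i, hi, by simp [hK]⟩
    · have hx0 : 0 < ‖x‖ := norm_pos_iff.mpr hx
      obtain ⟨i, hi, h⟩ := hnet ((‖x‖⁻¹ : ℂ) • x) (by
        rw [norm_smul]; simp [hx])
      refine ⟨i, hi, ?_⟩
      rw [inner_smul_right, norm_mul, mul_pow, norm_inv, Complex.norm_real, norm_norm, inv_pow,
        inv_mul_eq_div, le_div_iff₀ (by positivity)] at h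
      exact h
  have h1 : ENNReal.ofReal (Real.pi ^ (n + 1)) ≤
      ∑ i ∈ s, ENNReal.ofReal (Real.pi ^ (n + 1) * r ^ (2 * n)) := by
    rw [← integral_exp_neg_norm_sq, ofReal_integral_eq_lintegral_ofReal
      (integrable_exp_neg_norm_sq _) (Filter.Eventually.of_forall fun _ => (Real.exp_pos _).le),
      ← setLIntegral_univ, ← hcov]
    have hle := lintegral_iUnion_le (μ := volume) (fun i : s => K i)
      (fun x => ENNReal.ofReal (Real.exp (-‖x‖ ^ 2)))
    rw [tsum_fintype, Finset.sum_coe_sort s fun i =>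
      ∫⁻ x in K i, ENNReal.ofReal (Real.exp (-‖x‖ ^ 2)), Set.iUnion_subtype] at hle
    refine hle.trans (Finset.sum_le_sum fun i hi => ?_)
    rw [integral_exp_neg_norm_sq]
    exact setLIntegral_cone_le (hw i hi) hr
  rw [Finset.sum_const, nsmul_eq_mul, ← ENNReal.ofReal_natCast, ← ENNReal.ofReal_mul (by positivity),
    ENNReal.ofReal_le_ofReal_iff (by positivity), mul_left_comm] at h1
  have hp : 0 < Real.pi ^ (n + 1) := by positivity
  exact le_of_mul_le_mul_left (by linarith) hp

end Gaussian
-- Haar moments of transition probabilities, and functionals of time averages.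
section HaarMoment
open MeasureTheory Module

/-- The transition amplitude `⟨φ|A|ψ⟩`. -/
noncomputable def amplitude {d : ℕ} (φ : EuclideanSpace ℂ (Fin d)) (A : Matrix (Fin d) (Fin d) ℂ)
    (ψ : EuclideanSpace ℂ (Fin d)) : ℂ :=
  inner ℂ φ (Matrix.toEuclideanCLM (n := Fin d) (𝕜 := ℂ) A ψ)

theorem amplitude_eq_sum {d : ℕ} (φ : EuclideanSpace ℂ (Fin d)) (A : Matrix (Fin d) (Fin d) ℂ)
    (ψ : EuclideanSpace ℂ (Fin d)) :
    amplitude φ A ψ = ∑ a, ∑ b, star (φ a) * A a b * ψ b := by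
  rw [amplitude, PiLp.inner_apply]
  refine Finset.sum_congr rfl fun a _ => ?_
  simp only [Matrix.ofLp_toEuclideanCLM, RCLike.inner_apply, Matrix.mulVec, dotProduct,
    Finset.sum_mul, ← Complex.star_def]
  exact Finset.sum_congr rfl fun b _ => by ring

theorem amplitude_star_mul {d : ℕ} (φ : EuclideanSpace ℂ (Fin d)) (W V : Matrix (Fin d) (Fin d) ℂ)
    (ψ : EuclideanSpace ℂ (Fin d)) :
    amplitude (Matrix.toEuclideanCLM (n := Fin d) (𝕜 := ℂ) W φ) V ψ =
      amplitude φ (star W * V) ψ := by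
  rw [amplitude, amplitude, map_mul, map_star, ContinuousLinearMap.star_eq_adjoint]
  exact (ContinuousLinearMap.adjoint_inner_right _ _ _).symm

theorem amplitude_smul_left {d : ℕ} (c : ℝ) (φ : EuclideanSpace ℂ (Fin d))
    (A : Matrix (Fin d) (Fin d) ℂ) (ψ : EuclideanSpace ℂ (Fin d)) :
    amplitude (c • φ) A ψ = c * amplitude φ A ψ := by
  rw [amplitude, inner_smul_left_eq_smul]; simp [amplitude]

theorem continuous_amplitude {d : ℕ} (ψ : EuclideanSpace ℂ (Fin d)) :
    Continuous fun p : EuclideanSpace ℂ (Fin d) × Matrix (Fin d) (Fin d) ℂ =>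
      amplitude p.1 p.2 ψ := by
  simp_rw [amplitude_eq_sum]
  fun_prop

theorem norm_toEuclideanCLM_apply_of_unitary {d : ℕ} (V : Matrix.unitaryGroup (Fin d) ℂ)
    (ψ : EuclideanSpace ℂ (Fin d)) :
    ‖Matrix.toEuclideanCLM (n := Fin d) (𝕜 := ℂ) (V : Matrix (Fin d) (Fin d) ℂ) ψ‖ = ‖ψ‖ := by
  have h : star (V : Matrix (Fin d) (Fin d) ℂ) * V = 1 := (Unitary.mem_iff.mp V.2).1
  have h1 := amplitude_star_mul ψ (V : Matrix (Fin d) (Fin d) ℂ) V ψ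
  rw [h, amplitude, amplitude, map_one] at h1
  rw [norm_eq_sqrt_re_inner (𝕜 := ℂ), h1, norm_eq_sqrt_re_inner (𝕜 := ℂ) ψ]
  rfl

theorem exists_unitaryGroup_apply_eq {d : ℕ} {φ φ' : EuclideanSpace ℂ (Fin d)} (hφ : ‖φ‖ = 1)
    (hφ' : ‖φ'‖ = 1) : ∃ W : Matrix.unitaryGroup (Fin d) ℂ,
      Matrix.toEuclideanCLM (n := Fin d) (𝕜 := ℂ) (W : Matrix (Fin d) (Fin d) ℂ) φ = φ' := by
  obtain ⟨L, hL⟩ := exists_linearIsometryEquiv_apply_eq rfl hφ hφ'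
  set u := Unitary.linearIsometryEquiv.symm L with hu
  obtain ⟨W, hW⟩ := EquivLike.surjective (Matrix.toEuclideanCLM (n := Fin d) (𝕜 := ℂ))
    (u : EuclideanSpace ℂ (Fin d) →L[ℂ] EuclideanSpace ℂ (Fin d))
  refine ⟨⟨W, ?_⟩, ?_⟩
  · rw [Matrix.mem_unitaryGroup_iff']
    apply EquivLike.injective (Matrix.toEuclideanCLM (n := Fin d) (𝕜 := ℂ))
    rw [map_mul, map_star, map_one, hW, (Unitary.mem_iff.mp u.2).1]
  · change Matrix.toEuclideanCLM (n := Fin d) (𝕜 := ℂ) W φ = φ'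
    rw [hW, hu]
    simpa using hL

theorem integrable_norm_pow_mul_exp_neg_norm_sq (n k : ℕ) :
    Integrable fun x : EuclideanSpace ℂ (Fin (n + 1)) => ‖x‖ ^ (2 * k) * Real.exp (-‖x‖ ^ 2) := by
  refine not_imp_comm.mp integral_undef fun h => ?_
  have h1 := integral_norm_pow_mul_exp_neg_norm_sq
    (volume : Measure (EuclideanSpace ℂ (Fin (n + 1)))) (n := n)
    (finrank_real_euclideanSpace_complex _) k
  rw [h, integral_exp_neg_norm_sq, zero_mul] at h1
  have : 0 < ((n + k).factorial : ℝ) * Real.pi ^ (n + 1) := by positivity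
  linarith

theorem continuous_amplitude_unitaryGroup {d : ℕ} (ψ : EuclideanSpace ℂ (Fin d)) :
    Continuous fun p : EuclideanSpace ℂ (Fin d) × Matrix.unitaryGroup (Fin d) ℂ =>
      amplitude p.1 (p.2 : Matrix (Fin d) (Fin d) ℂ) ψ := by
  have h1 : Continuous fun V : Matrix.unitaryGroup (Fin d) ℂ => (V : Matrix (Fin d) (Fin d) ℂ) :=
    continuous_subtype_val
  have h2 := continuous_fst.prodMk (h1.comp (continuous_snd (X := EuclideanSpace ℂ (Fin d))))
  have h3 := (continuous_amplitude ψ).comp h2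
  exact h3

theorem integrable_norm_amplitude_pow_mul_exp {n : ℕ} {ψ : EuclideanSpace ℂ (Fin (n + 1))}
    (hψ : ‖ψ‖ = 1) (k : ℕ) [MeasurableSpace (Matrix.unitaryGroup (Fin (n + 1)) ℂ)]
    [BorelSpace (Matrix.unitaryGroup (Fin (n + 1)) ℂ)]
    (μ : Measure (Matrix.unitaryGroup (Fin (n + 1)) ℂ)) [IsProbabilityMeasure μ] :
    Integrable (Function.uncurry fun (x : EuclideanSpace ℂ (Fin (n + 1)))
      (V : Matrix.unitaryGroup (Fin (n + 1)) ℂ) => ‖amplitude x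
      (V : Matrix (Fin (n + 1)) (Fin (n + 1)) ℂ) ψ‖ ^ (2 * k) * Real.exp (-‖x‖ ^ 2))
      (volume.prod μ) := by
  have h1 := continuous_amplitude_unitaryGroup ψ
  have h2 : Continuous fun p : EuclideanSpace ℂ (Fin (n + 1)) ×
      Matrix.unitaryGroup (Fin (n + 1)) ℂ => ‖amplitude p.1
      (p.2 : Matrix (Fin (n + 1)) (Fin (n + 1)) ℂ) ψ‖ ^ (2 * k) * Real.exp (-‖p.1‖ ^ 2) := by
    have h4 : Continuous fun p : EuclideanSpace ℂ (Fin (n + 1)) ×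
      Matrix.unitaryGroup (Fin (n + 1)) ℂ => Real.exp (-‖p.1‖ ^ 2) := by fun_prop
    have h5 := h1.norm
    have h6 := h5.pow (2 * k)
    exact h6.mul h4
  have h3 := (integrable_norm_pow_mul_exp_neg_norm_sq n k).comp_fst μ
  refine h3.mono' h2.aestronglyMeasurable (Filter.Eventually.of_forall fun p => ?_)
  simp only [Function.uncurry]
  rw [norm_mul, Real.norm_eq_abs (Real.exp _), Real.abs_exp, norm_pow, norm_norm]
  gcongr
  refine (norm_inner_le_norm _ _).trans ?_
  rw [norm_toEuclideanCLM_apply_of_unitary, hψ, mul_one]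

/-- The Haar moments of the transition probabilities. -/
theorem haarAverage_norm_amplitude_pow {n k : ℕ} (hk : 1 ≤ k)
    {φ ψ : EuclideanSpace ℂ (Fin (n + 1))} (hφ : ‖φ‖ = 1) (hψ : ‖ψ‖ = 1) :
    haarAverage (fun V : Matrix.unitaryGroup (Fin (n + 1)) ℂ =>
      ‖amplitude φ (V : Matrix (Fin (n + 1)) (Fin (n + 1)) ℂ) ψ‖ ^ (2 * k)) =
      n.factorial * k.factorial / (n + k).factorial := by
  let : MeasurableSpace (Matrix.unitaryGroup (Fin (n + 1)) ℂ) := borel _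
  have : BorelSpace (Matrix.unitaryGroup (Fin (n + 1)) ℂ) := ⟨rfl⟩
  have : CompactSpace (Matrix.unitaryGroup (Fin (n + 1)) ℂ) := compactSpace_unitaryGroup _
  set μ : Measure (Matrix.unitaryGroup (Fin (n + 1)) ℂ) := Measure.haarMeasure
    (⊤ : TopologicalSpace.PositiveCompacts (Matrix.unitaryGroup (Fin (n + 1)) ℂ)) with hμ
  have : IsProbabilityMeasure μ := ⟨Measure.haarMeasure_self⟩
  set h : EuclideanSpace ℂ (Fin (n + 1)) → ℝ := fun x => ∫ V, ‖amplitude x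
    (V : Matrix (Fin (n + 1)) (Fin (n + 1)) ℂ) ψ‖ ^ (2 * k) ∂μ with hh
  change h φ = _
  have hunit : ∀ x, ‖x‖ = 1 → h x = h φ := by
    intro x hx
    -- The unitary group is transitive on unit vectors, so left invariance of Haar measure makes `h`
    -- constant on the sphere.
    obtain ⟨W, rfl⟩ := exists_unitaryGroup_apply_eq hφ hx
    simp only [hh, amplitude_star_mul]
    exact integral_mul_left_eq_self (μ := μ) (fun V : Matrix.unitaryGroup (Fin (n + 1)) ℂ =>
      ‖amplitude φ (V : Matrix (Fin (n + 1)) (Fin (n + 1)) ℂ) ψ‖ ^ (2 * k)) (star W)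
  have hscale : ∀ x, h x = h φ * ‖x‖ ^ (2 * k) := by
    intro x
    rcases eq_or_ne x 0 with rfl | hx
    · have : 2 * k ≠ 0 := by omega
      simp [hh, amplitude, this]
    · have hx0 : ‖x‖ ≠ 0 := norm_ne_zero_iff.mpr hx
      rw [← hunit (‖x‖⁻¹ • x) (by rw [norm_smul]; simp [hx])]
      simp only [hh, amplitude_smul_left, norm_mul, mul_pow]
      rw [integral_const_mul, mul_right_comm, ← mul_pow]
      simp [hx0]
  have hprod := integrable_norm_amplitude_pow_mul_exp hψ k μ
  -- Integrate over Gaussian `x` and Haar `V` in both orders. Integrating `V` first gives `h φ`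
  -- times a Gaussian norm moment; integrating `x` first gives a value independent of `V`.
  -- Comparison determines `h φ`.
  have hswap := integral_integral_swap hprod
  have hl : ∀ x, ∫ V, ‖amplitude x (V : Matrix (Fin (n + 1)) (Fin (n + 1)) ℂ) ψ‖ ^ (2 * k) *
      Real.exp (-‖x‖ ^ 2) ∂μ = h φ * (‖x‖ ^ (2 * k) * Real.exp (-‖x‖ ^ 2)) := by
    intro x
    rw [integral_mul_const, ← mul_assoc, ← hscale]
  have hr : ∀ V : Matrix.unitaryGroup (Fin (n + 1)) ℂ,
      ∫ x, ‖amplitude x (V : Matrix (Fin (n + 1)) (Fin (n + 1)) ℂ) ψ‖ ^ (2 * k) *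
      Real.exp (-‖x‖ ^ 2) = k.factorial * Real.pi ^ (n + 1) := by
    intro V
    rw [← integral_norm_inner_pow_mul_exp_neg_norm_sq
      (u := Matrix.toEuclideanCLM (n := Fin (n + 1)) (𝕜 := ℂ) V ψ)
      (by rw [norm_toEuclideanCLM_apply_of_unitary, hψ]) k]
    simp_rw [amplitude, norm_inner_symm]
  simp_rw [hl, hr] at hswap
  rw [integral_const_mul, integral_const, probReal_univ, one_smul] at hswap
  have h1 := integral_norm_pow_mul_exp_neg_norm_sq
    (volume : Measure (EuclideanSpace ℂ (Fin (n + 1)))) (n := n)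
    (finrank_real_euclideanSpace_complex _) k
  rw [integral_exp_neg_norm_sq] at h1
  rw [eq_div_iff (by positivity)]
  have hp : (Real.pi : ℝ) ^ (n + 1) ≠ 0 := by positivity
  refine mul_right_cancel₀ hp ?_
  linear_combination (n.factorial : ℝ) * hswap - h φ * h1

theorem map_haarAverage {d : ℕ} {E F : Type*} [NormedAddCommGroup E] [NormedSpace ℝ E]
    [CompleteSpace E] [NormedAddCommGroup F] [NormedSpace ℝ F] [CompleteSpace F]
    (L : E →L[ℝ] F) {f : Matrix.unitaryGroup (Fin d) ℂ → E} (hf : Continuous f) :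
    L (haarAverage f) = haarAverage fun V => L (f V) := by
  let : MeasurableSpace (Matrix.unitaryGroup (Fin d) ℂ) := borel _
  have : BorelSpace (Matrix.unitaryGroup (Fin d) ℂ) := ⟨rfl⟩
  have : CompactSpace (Matrix.unitaryGroup (Fin d) ℂ) := compactSpace_unitaryGroup _
  have : IsProbabilityMeasure (Measure.haarMeasure
    (⊤ : TopologicalSpace.PositiveCompacts (Matrix.unitaryGroup (Fin d) ℂ))) :=
    ⟨Measure.haarMeasure_self⟩
  exact (L.integral_comp_comm (hf.integrable_of_hasCompactSupport
    (HasCompactSupport.of_compactSpace f))).symm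

/-- A continuous linear functional of a time average is at most any bound for the values. -/
theorem HasTimeAverage.map_le {E : Type*} [NormedAddCommGroup E] [NormedSpace ℝ E]
    [CompleteSpace E] {f : ℝ → E} {m : E} (hf : HasTimeAverage f m) (L : E →L[ℝ] ℝ) {c : ℝ}
    (hc : 0 ≤ c) (hL : ∀ t, 0 ≤ t → L (f t) ≤ c) : L m ≤ c := by
  refine le_of_tendsto ((L.continuous.tendsto m).comp hf) ?_
  filter_upwards [Filter.eventually_gt_atTop 0] with S hS
  have hI : L (∫ t in (0 : ℝ)..S, f t) ≤ c * S := by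
    by_cases hi : IntervalIntegrable f volume 0 S
    · rw [← L.intervalIntegral_comp_comm hi]
      have h := intervalIntegral.integral_mono_on hS.le
        (show IntervalIntegrable (fun t => L (f t)) volume 0 S from
          ⟨L.integrable_comp hi.1, L.integrable_comp hi.2⟩)
        (intervalIntegrable_const (c := c)) fun t ht => hL t ht.1
      simpa [mul_comm] using h
    -- Without integrability the integral defaults to `0`; this is where `0 ≤ c` enters.
    · rw [intervalIntegral.integral_undef hi, map_zero]
      positivity
  simp only [Function.comp_apply, map_smul, smul_eq_mul]
  rw [inv_mul_le_iff₀ hS]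
  linarith

end HaarMoment

/-! ### From `k`-HSE or `k`-UE to moment bounds along orbits. -/

section Moments

/-- The real part of the pairing of a matrix on multi-indices with the tensor power of `W`. -/
noncomputable def tensorPairing {ι : Type*} [Fintype ι] [DecidableEq ι] (k : ℕ)
    (W : Matrix ι ι ℂ) : Matrix (Fin k → ι) (Fin k → ι) ℂ →L[ℝ] ℝ :=
  LinearMap.toContinuousLinearMap
    { toFun := fun M => (∑ a, ∑ b, M a b * tensorPow k W a b).re
      map_add' := fun M N => by simp [add_mul, Finset.sum_add_distrib]
      map_smul' := fun c M => by
        simp only [Matrix.smul_apply, smul_mul_assoc, ← Finset.smul_sum, Complex.smul_re,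
          RingHom.id_apply] }

theorem tensorPairing_apply {ι : Type*} [Fintype ι] [DecidableEq ι] (k : ℕ)
    (W : Matrix ι ι ℂ) (M : Matrix (Fin k → ι) (Fin k → ι) ℂ) :
    tensorPairing k W M = (∑ a, ∑ b, M a b * tensorPow k W a b).re := rfl

/-- The sum over multi-indices of a product over the `k` factors is the product of the sums, and all
factors are equal. -/
theorem tensorPairing_tensorPow {ι : Type*} [Fintype ι] [DecidableEq ι] (k : ℕ)
    (W A : Matrix ι ι ℂ) :
    tensorPairing k W (tensorPow k A) = ((∑ p, ∑ q, A p q * W p q) ^ k).re := by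
  rw [tensorPairing_apply]
  congr 1
  have h1 : ∀ a : Fin k → ι, ∑ b, tensorPow k A a b * tensorPow k W a b =
      ∏ i, ∑ q, A (a i) q * W (a i) q := fun a => by
    rw [Finset.prod_univ_sum, Fintype.piFinset_univ]
    simp [tensorPow, Finset.prod_mul_distrib]
  simp_rw [h1]
  have h2 := Finset.prod_univ_sum (fun _ : Fin k => (Finset.univ : Finset ι))
    fun _ p => ∑ q, A p q * W p q
  rw [Fintype.piFinset_univ] at h2
  rw [← h2, Finset.prod_const, Finset.card_univ, Fintype.card_fin]

theorem continuous_tensorPow {ι X : Type*} [TopologicalSpace X] (k : ℕ) {A : X → Matrix ι ι ℂ}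
    (hA : Continuous A) : Continuous fun x => tensorPow k (A x) :=
  continuous_matrix fun a b => by
    simpa [tensorPow] using continuous_finsetProd (Finset.univ : Finset (Fin k))
      fun i _ => hA.matrix_elem (a i) (b i)

theorem continuous_stateMoment {d : ℕ} (k : ℕ) (ψ : EuclideanSpace ℂ (Fin d)) :
    Continuous (stateMoment k ψ) := by
  refine continuous_tensorPow k ?_
  have : Continuous fun V : Matrix.unitaryGroup (Fin d) ℂ => (V : Matrix (Fin d) (Fin d) ℂ) :=
    continuous_subtype_val
  exact (this.mul continuous_const).mul this.matrix_conjTranspose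

theorem continuous_unitaryMoment {d : ℕ} (k : ℕ) : Continuous (unitaryMoment (d := d) k) := by
  refine continuous_tensorPow k (continuous_matrix fun i j => ?_)
  have : Continuous fun V : Matrix.unitaryGroup (Fin d) ℂ => (V : Matrix (Fin d) (Fin d) ℂ) :=
    continuous_subtype_val
  simp only [Matrix.kroneckerMap_apply, Matrix.map_apply]
  exact (this.matrix_elem _ _).star.mul (this.matrix_elem _ _)

theorem mul_star_eq_norm_sq (z : ℂ) : z * star z = ((‖z‖ ^ 2 : ℝ) : ℂ) := by
  rw [Complex.star_def, Complex.mul_conj, Complex.normSq_eq_norm_sq]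

/-- The pairing involves no conjugation or transposition, so the chosen matrix is the transpose of
`|φ⟩⟨φ|`; the single-copy pairing is then `⟨φ|VψV†|φ⟩`. -/
theorem tensorPairing_stateMoment {d : ℕ} (k : ℕ) (φ ψ : EuclideanSpace ℂ (Fin d))
    (V : Matrix.unitaryGroup (Fin d) ℂ) :
    tensorPairing k (Matrix.of fun a b => star (φ a) * φ b) (stateMoment k ψ V) =
      ‖amplitude φ (V : Matrix (Fin d) (Fin d) ℂ) ψ‖ ^ (2 * k) := by
  rw [stateMoment, tensorPairing_tensorPow]
  have h : ∑ p, ∑ q, ((V : Matrix (Fin d) (Fin d) ℂ) * density ψ *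
      (V : Matrix (Fin d) (Fin d) ℂ)ᴴ) p q * (Matrix.of fun a b => star (φ a) * φ b) p q =
      ((‖amplitude φ (V : Matrix (Fin d) (Fin d) ℂ) ψ‖ ^ 2 : ℝ) : ℂ) := by
    have h1 : ∀ p q, ((V : Matrix (Fin d) (Fin d) ℂ) * density ψ *
        (V : Matrix (Fin d) (Fin d) ℂ)ᴴ) p q =
        (∑ b, (V : Matrix (Fin d) (Fin d) ℂ) p b * ψ b) *
          star (∑ b, (V : Matrix (Fin d) (Fin d) ℂ) q b * ψ b) := fun p q => by
      simp only [Matrix.mul_apply, density, Matrix.of_apply, Matrix.conjTranspose_apply, star_sum,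
        star_mul', Finset.sum_mul, Finset.mul_sum]
      refine Finset.sum_congr rfl fun a _ => Finset.sum_congr rfl fun b _ => ?_
      ring
    have h2 : amplitude φ (V : Matrix (Fin d) (Fin d) ℂ) ψ =
        ∑ a, star (φ a) * ∑ b, (V : Matrix (Fin d) (Fin d) ℂ) a b * ψ b := by
      simp_rw [amplitude_eq_sum, Finset.mul_sum, mul_assoc]
    rw [← mul_star_eq_norm_sq, h2, star_sum, Finset.sum_mul_sum]
    simp_rw [h1]
    refine Finset.sum_congr rfl fun p _ => Finset.sum_congr rfl fun q _ => ?_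
    simp only [Matrix.of_apply, star_mul', star_star]
    ring
  rw [h, ← Complex.ofReal_pow, Complex.ofReal_re, pow_mul]

/-- The two Kronecker factors extract the conjugate of `⟨φ|V|ψ⟩` and the amplitude itself, so
unitary moments test the same transition probabilities as state moments. -/
theorem tensorPairing_unitaryMoment {d : ℕ} (k : ℕ) (φ ψ : EuclideanSpace ℂ (Fin d))
    (V : Matrix.unitaryGroup (Fin d) ℂ) :
    tensorPairing k ((Matrix.of fun a b => φ a * star (ψ b)) ⊗ₖ
      (Matrix.of fun a b => star (φ a) * ψ b)) (unitaryMoment k V) =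
      ‖amplitude φ (V : Matrix (Fin d) (Fin d) ℂ) ψ‖ ^ (2 * k) := by
  rw [unitaryMoment, tensorPairing_tensorPow, pow_mul, ← Complex.ofReal_re
    ((‖amplitude φ (V : Matrix (Fin d) (Fin d) ℂ) ψ‖ ^ 2) ^ k), Complex.ofReal_pow,
    ← mul_star_eq_norm_sq]
  congr 2
  rw [amplitude_eq_sum, mul_comm, star_sum]
  simp_rw [star_sum, Fintype.sum_prod_type, Finset.sum_mul_sum]
  refine Finset.sum_congr rfl fun p _ => Finset.sum_congr rfl fun q _ =>
    Finset.sum_congr rfl fun r _ => Finset.sum_congr rfl fun s _ => ?_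
  simp only [Matrix.kroneckerMap_apply, Matrix.map_apply, Matrix.of_apply, star_mul', star_star]
  ring

/-- Every uniform bound on the `k`-th powers of the transition probabilities along an orbit is at
least their Haar average. -/
def OrbitMomentBound {d : ℕ} (U : ℝ → Matrix.unitaryGroup (Fin d) ℂ) (k : ℕ) : Prop :=
  ∀ φ ψ : EuclideanSpace ℂ (Fin d), ‖φ‖ = 1 → ‖ψ‖ = 1 → ∀ c : ℝ, 0 ≤ c →
    (∀ t, 0 ≤ t → ‖amplitude φ (U t : Matrix (Fin d) (Fin d) ℂ) ψ‖ ^ (2 * k) ≤ c) →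
    ((d - 1).factorial * k.factorial : ℝ) / (d + k - 1).factorial ≤ c

theorem haarAverage_norm_amplitude_pow_of_pos {d k : ℕ} (hd : 1 ≤ d) (hk : 1 ≤ k)
    {φ ψ : EuclideanSpace ℂ (Fin d)} (hφ : ‖φ‖ = 1) (hψ : ‖ψ‖ = 1) :
    haarAverage (fun V : Matrix.unitaryGroup (Fin d) ℂ =>
      ‖amplitude φ (V : Matrix (Fin d) (Fin d) ℂ) ψ‖ ^ (2 * k)) =
      ((d - 1).factorial * k.factorial : ℝ) / (d + k - 1).factorial := by
  obtain ⟨n, rfl⟩ := Nat.exists_eq_add_of_le' hd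
  rw [haarAverage_norm_amplitude_pow hk hφ hψ, Nat.add_sub_cancel,
    show n + 1 + k - 1 = n + k by omega]

theorem IsHSE.orbitMomentBound {d k : ℕ} (hd : 1 ≤ d) (hk : 1 ≤ k)
    {U : ℝ → Matrix.unitaryGroup (Fin d) ℂ} (h : IsHSE U k) : OrbitMomentBound U k := by
  intro φ ψ hφ hψ c hc hb
  have h1 := (h ψ hψ).map_le (tensorPairing k (Matrix.of fun a b => star (φ a) * φ b)) hc
    fun t ht => by rw [tensorPairing_stateMoment]; exact hb t ht
  rw [map_haarAverage _ (continuous_stateMoment k ψ)] at h1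
  simp_rw [tensorPairing_stateMoment] at h1
  rwa [haarAverage_norm_amplitude_pow_of_pos hd hk hφ hψ] at h1

/-- This yields the obstruction for `k`-UE directly, without deducing `k`-HSE from it. -/
theorem IsUE.orbitMomentBound {d k : ℕ} (hd : 1 ≤ d) (hk : 1 ≤ k)
    {U : ℝ → Matrix.unitaryGroup (Fin d) ℂ} (h : IsUE U k) : OrbitMomentBound U k := by
  intro φ ψ hφ hψ c hc hb
  have h1 := HasTimeAverage.map_le h (tensorPairing k ((Matrix.of fun a b => φ a * star (ψ b)) ⊗ₖ
      (Matrix.of fun a b => star (φ a) * ψ b))) hc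
    fun t ht => by rw [tensorPairing_unitaryMoment]; exact hb t ht
  rw [map_haarAverage _ (continuous_unitaryMoment k)] at h1
  simp_rw [tensorPairing_unitaryMoment] at h1
  rwa [haarAverage_norm_amplitude_pow_of_pos hd hk hφ hψ] at h1

end Moments
-- Speed of the evolution and Floquet's theorem, with pulses.
section Propagator
open MeasureTheory

/-- Induction along the reals, starting at `a`. -/
theorem real_induction {a : ℝ} {P : ℝ → Prop} (h0 : P a)
    (hstep : ∀ t, a ≤ t → P t → ∃ t' > t, ∀ r ∈ Set.Ioc t t', P r)
    (hlim : ∀ t, a < t → (∀ r ∈ Set.Ico a t, P r) → P t) : ∀ t, a ≤ t → P t := by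
  by_contra! hcon
  obtain ⟨t₀, ht₀, hP⟩ := hcon
  set S := {t | a ≤ t ∧ ¬ P t} with hS
  have hbdd : BddBelow S := ⟨a, fun t ht => ht.1⟩
  have hne : S.Nonempty := ⟨t₀, ht₀, hP⟩
  have ham : a ≤ sInf S := le_csInf hne fun t ht => ht.1
  have hbelow : ∀ r ∈ Set.Ico a (sInf S), P r := fun r hr =>
    by_contra fun h => (csInf_le hbdd ⟨hr.1, h⟩).not_gt hr.2
  have hPm : P (sInf S) := by
    rcases ham.eq_or_lt with h | h
    · rwa [← h]
    · exact hlim _ h hbelow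
  obtain ⟨t', ht', h⟩ := hstep _ ham hPm
  have : t' ≤ sInf S := le_csInf hne fun t ht => by
    by_contra! hlt
    rcases (csInf_le hbdd ht).eq_or_lt with h1 | h1
    · exact ht.2 (h1 ▸ hPm)
    · exact ht.2 (h t ⟨h1, hlt.le⟩)
  exact this.not_gt ht'

/-- The path `x ↦ exp (x • A)` is unitary, hence has constant speed `‖A‖ = ‖K‖`; apply the mean
value inequality on `[0, 1]`. -/
theorem norm_exp_neg_I_smul_sub_one_le {d : ℕ} {K : Matrix (Fin d) (Fin d) ℂ}
    (hK : K.IsHermitian) : ‖NormedSpace.exp (-(Complex.I • K)) - 1‖ ≤ ‖K‖ := by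
  set A : Matrix (Fin d) (Fin d) ℂ := -(Complex.I • K) with hA
  have hAK : ‖A‖ = ‖K‖ := by simp [hA, norm_smul]
  have hskew : A ∈ skewAdjoint (Matrix (Fin d) (Fin d) ℂ) := by
    rw [skewAdjoint.mem_iff, hA, star_neg, star_smul, Matrix.star_eq_conjTranspose, hK.eq]
    simp
  have h := norm_image_sub_le_of_norm_deriv_le_segment_01' (C := ‖K‖)
    (f := fun x : ℝ => NormedSpace.exp (x • A)) (f' := fun x => A * NormedSpace.exp (x • A))
    (fun x _ => (hasDerivAt_exp_smul_const' A x).hasDerivWithinAt) fun x _ => by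
      let : NormedAlgebra ℚ (Matrix (Fin d) (Fin d) ℂ) := NormedAlgebra.restrictScalars ℚ ℂ _
      have hu : NormedSpace.exp (x • A) ∈ unitary (Matrix (Fin d) (Fin d) ℂ) :=
        NormedSpace.exp_mem_unitary_of_mem_skewAdjoint (skewAdjoint.smul_mem x hskew)
      rw [← hAK]
      exact (CStarRing.norm_mul_mem_unitary A hu).le
  simpa using h

/-- A bounded solution of the homogeneous linear Volterra equation with a small kernel vanishes. -/
theorem eq_zero_of_eq_integral_mul {A : Type*} [NormedRing A] [NormedAlgebra ℝ A]
    {g X : ℝ → A} {a b C : ℝ} (hg : IntervalIntegrable (fun r => ‖g r‖) volume a b)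
    (hsmall : ∫ r in a..b, ‖g r‖ ≤ 1 / 2) (hC : ∀ t ∈ Set.Icc a b, ‖X t‖ ≤ C)
    (hX : ∀ t ∈ Set.Icc a b, ‖X t‖ ≤ ‖∫ r in a..t, g r * X r‖) :
    ∀ t ∈ Set.Icc a b, X t = 0 := by
  have key : ∀ n : ℕ, ∀ t ∈ Set.Icc a b, ‖X t‖ ≤ (1 / 2) ^ n * C := by
    intro n
    induction n with
    | zero => simpa using hC
    | succ n ih =>
      intro t ht
      have hC0 : 0 ≤ (1 / 2) ^ n * C := (norm_nonneg _).trans (ih t ht)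
      have hsub : IntervalIntegrable (fun r => ‖g r‖) volume a t :=
        hg.mono_set (by rw [Set.uIcc_of_le ht.1, Set.uIcc_of_le (ht.1.trans ht.2)]
                        exact Set.Icc_subset_Icc_right ht.2)
      calc ‖X t‖ ≤ ‖∫ r in a..t, g r * X r‖ := hX t ht
        _ ≤ ∫ r in a..t, ‖g r‖ * ((1 / 2) ^ n * C) := by
          refine intervalIntegral.norm_integral_le_of_norm_le ht.1
            (Filter.Eventually.of_forall fun r hr => ?_) (hsub.mul_const _)
          refine (norm_mul_le _ _).trans ?_
          exact mul_le_mul_of_nonneg_left (ih r ⟨hr.1.le, hr.2.trans ht.2⟩) (norm_nonneg _)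
        _ = (∫ r in a..t, ‖g r‖) * ((1 / 2) ^ n * C) := by
          rw [intervalIntegral.integral_mul_const]
        _ ≤ 1 / 2 * ((1 / 2) ^ n * C) := by
          refine mul_le_mul_of_nonneg_right (le_trans ?_ hsmall) hC0
          exact intervalIntegral.integral_mono_interval le_rfl ht.1 ht.2
            (Filter.Eventually.of_forall fun _ => norm_nonneg _) hg
        _ = (1 / 2) ^ (n + 1) * C := by ring
  intro t ht
  have hlim : Filter.Tendsto (fun n : ℕ => ((1 : ℝ) / 2) ^ n * C) Filter.atTop (𝓝 (0 * C)) :=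
    (tendsto_pow_atTop_nhds_zero_of_lt_one (by norm_num) (by norm_num)).mul_const C
  rw [zero_mul] at hlim
  exact norm_le_zero_iff.mp (ge_of_tendsto' hlim fun n => key n t ht)

namespace PeriodicHamiltonian

variable {d : ℕ} {T : ℝ}

theorem intervalIntegrable_norm_reg (H : PeriodicHamiltonian d T) (hT : 0 < T) (a b : ℝ) :
    IntervalIntegrable (fun r => ‖H.reg r‖) volume a b :=
  (H.reg_periodic.intervalIntegrable₀ hT.ne' H.reg_integrable a b).norm

/-- This allows the Schrödinger equation to be used to the right of any time. Reduce `t` to `t₀ ∈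
[0, T)`: the finitely many pulses after `t₀` stay away from it, and stopping by `T` keeps the
shifted times in `(0, T]`. -/
theorem exists_kick_eq_zero (H : PeriodicHamiltonian d T) (hT : 0 < T) (t : ℝ) :
    ∃ t' > t, ∀ r ∈ Set.Ioc t t', H.kick r = 0 := by
  set t₀ := toIcoMod hT 0 t with ht₀
  have hmem : t₀ ∈ Set.Ico 0 T := by simpa using toIcoMod_mem_Ico hT 0 t
  have hshift : ∀ x, H.kick (t₀ + x) = H.kick (t + x) := fun x => by
    have : t + x = t₀ + x + toIcoDiv hT 0 t • T := by
      rw [ht₀, ← self_sub_toIcoDiv_zsmul]; ring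
    rw [this, H.kick_periodic.zsmul]
  have hfin : ({t | t ∈ Set.Ioc 0 T ∧ H.kick t ≠ 0} ∩ Set.Ioi t₀).Finite :=
    H.kick_finite.subset Set.inter_subset_left
  have hnhds := hfin.isClosed.isOpen_compl.mem_nhds
    (show t₀ ∈ ({t | t ∈ Set.Ioc 0 T ∧ H.kick t ≠ 0} ∩ Set.Ioi t₀)ᶜ from
      fun h => lt_irrefl t₀ h.2)
  obtain ⟨ε, hε, hball⟩ := Metric.mem_nhds_iff.mp hnhds
  refine ⟨t + min (ε / 2) (T - t₀), by
    have : 0 < min (ε / 2) (T - t₀) := lt_min (by linarith) (by linarith [hmem.2])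
    linarith, fun r hr => ?_⟩
  have h1 : r - t ≤ ε / 2 := by linarith [hr.2, min_le_left (ε / 2) (T - t₀)]
  have h2 : r - t ≤ T - t₀ := by linarith [hr.2, min_le_right (ε / 2) (T - t₀)]
  have h3 : t₀ + (r - t) ∈ Metric.ball t₀ ε := by
    rw [Metric.mem_ball, Real.dist_eq, add_sub_cancel_left, abs_of_pos (by linarith [hr.1])]
    linarith
  have h4 := hball h3
  rw [show r = t + (r - t) by ring, ← hshift]
  by_contra h5
  exact h4 ⟨⟨⟨by linarith [hmem.1, hr.1], by linarith⟩, h5⟩, by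
    rw [Set.mem_Ioi]; linarith [hr.1]⟩

/-- The strength accumulated up to time `t ∈ [0, T]`. -/
noncomputable def cumulativeStrength (H : PeriodicHamiltonian d T) (t : ℝ) : ℝ :=
  (∫ r in (0 : ℝ)..t, ‖H.reg r‖) + ∑ τ ∈ H.kick_finite.toFinset with τ ≤ t, ‖H.kick τ‖

theorem cumulativeStrength_period (H : PeriodicHamiltonian d T) :
    H.cumulativeStrength T = H.strength := by
  rw [cumulativeStrength, strength]
  congr 1
  rw [finsum_mem_eq_sum_of_inter_support_eq (t := H.kick_finite.toFinset)]
  · refine Finset.sum_congr (Finset.filter_true_of_mem fun τ hτ => ?_) fun _ _ => rfl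
    exact (H.kick_finite.mem_toFinset.mp hτ).1.2
  · ext τ
    simp

theorem cumulativeStrength_add_le (H : PeriodicHamiltonian d T) (hT : 0 < T) {s t : ℝ}
    (hst : s ≤ t) :
    H.cumulativeStrength s + ∫ r in s..t, ‖H.reg r‖ ≤ H.cumulativeStrength t := by
  rw [cumulativeStrength, cumulativeStrength, ← intervalIntegral.integral_add_adjacent_intervals
    (H.intervalIntegrable_norm_reg hT 0 s) (H.intervalIntegrable_norm_reg hT s t)]
  have := Finset.sum_le_sum_of_subset_of_nonneg (f := fun τ => ‖H.kick τ‖)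
    (s := H.kick_finite.toFinset.filter (· ≤ s)) (t := H.kick_finite.toFinset.filter (· ≤ t))
    (Finset.monotone_filter_right _ fun τ _ h => h.trans hst) fun _ _ _ => norm_nonneg _
  linarith

theorem cumulativeStrength_mono (H : PeriodicHamiltonian d T) (hT : 0 < T) :
    Monotone H.cumulativeStrength := fun s t hst => by
  have := H.cumulativeStrength_add_le hT hst
  have h := intervalIntegral.integral_nonneg (μ := volume) hst fun r _ => norm_nonneg (H.reg r)
  linarith

theorem cumulativeStrength_add_norm_kick_le (H : PeriodicHamiltonian d T) (hT : 0 < T) {s t : ℝ}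
    (hs : 0 ≤ s) (hst : s < t) (htT : t ≤ T) :
    H.cumulativeStrength s + ‖H.kick t‖ ≤ H.cumulativeStrength t := by
  by_cases hk : H.kick t = 0
  · simpa [hk] using H.cumulativeStrength_mono hT hst.le
  have ht : t ∈ H.kick_finite.toFinset :=
    H.kick_finite.mem_toFinset.mpr ⟨⟨hs.trans_lt hst, htT⟩, hk⟩
  have h1 := Finset.sum_le_sum_of_subset_of_nonneg (f := fun τ => ‖H.kick τ‖)
    (s := insert t (H.kick_finite.toFinset.filter (· ≤ s)))
    (t := H.kick_finite.toFinset.filter (· ≤ t))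
    (Finset.insert_subset (Finset.mem_filter.mpr ⟨ht, le_rfl⟩)
      (Finset.monotone_filter_right _ fun τ _ h => h.trans hst.le)) fun _ _ _ => norm_nonneg _
  rw [Finset.sum_insert (by simp [hst])] at h1
  have h2 : ∫ r in (0 : ℝ)..s, ‖H.reg r‖ ≤ ∫ r in (0 : ℝ)..t, ‖H.reg r‖ :=
    intervalIntegral.integral_mono_interval le_rfl hs hst.le
      (Filter.Eventually.of_forall fun _ => norm_nonneg _) (H.intervalIntegrable_norm_reg hT 0 t)
  rw [cumulativeStrength, cumulativeStrength]
  linarith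

theorem cumulativeStrength_nonneg (H : PeriodicHamiltonian d T) {t : ℝ} (ht : 0 ≤ t) :
    0 ≤ H.cumulativeStrength t :=
  add_nonneg (intervalIntegral.integral_nonneg ht fun _ _ => norm_nonneg _)
    (Finset.sum_nonneg fun _ _ => norm_nonneg _)

namespace IsPropagator

variable {H : PeriodicHamiltonian d T} {U : ℝ → Matrix.unitaryGroup (Fin d) ℂ}

/-- The orbit moves in operator norm by at most the strength spent. -/
theorem norm_sub_le (hU : H.IsPropagator U) (hT : 0 < T) {s t : ℝ} (hs : 0 ≤ s) (hst : s ≤ t)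
    (htT : t ≤ T) : ‖(U t : Matrix (Fin d) (Fin d) ℂ) - U s‖ ≤
      H.cumulativeStrength t - H.cumulativeStrength s := by
  refine real_induction (P := fun t => t ≤ T → ‖(U t : Matrix (Fin d) (Fin d) ℂ) - U s‖ ≤
      H.cumulativeStrength t - H.cumulativeStrength s) (by simp) ?_ ?_ t hst htT
  · intro t hst hP
    obtain ⟨t', ht', hk⟩ := H.exists_kick_eq_zero hT t
    refine ⟨t', ht', fun r hr hrT => ?_⟩
    have h1 := hU.schrodinger t r (hs.trans hst) hr.1.le fun x hx => hk x ⟨hx.1, hx.2.trans hr.2⟩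
    have h2 : ‖(U r : Matrix (Fin d) (Fin d) ℂ) - U t‖ ≤ ∫ x in t..r, ‖H.reg x‖ := by
      rw [h1, sub_sub_cancel_left, norm_neg, norm_smul, Complex.norm_I, one_mul]
      refine (intervalIntegral.norm_integral_le_integral_norm hr.1.le).trans (le_of_eq ?_)
      exact intervalIntegral.integral_congr fun x _ => CStarRing.norm_mul_coe_unitary _ _
    have h3 := H.cumulativeStrength_add_le hT hr.1.le
    have h4 := norm_sub_le_norm_sub_add_norm_sub (U r : Matrix (Fin d) (Fin d) ℂ) (U t) (U s)
    linarith [hP (hr.1.le.trans hrT)]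
  -- At `t` the state is the limit of `exp (-i K) U(r)` as `r` increases to `t`. The pulse costs at
  -- most `‖K‖`, which `cumulativeStrength` counts at `t` but not before.
  · intro t hst hP htT
    refine le_of_tendsto (((hU.pulse t (hs.trans_lt hst)).sub_const
      (U s : Matrix (Fin d) (Fin d) ℂ)).norm) ?_
    filter_upwards [Ico_mem_nhdsLT hst] with r hr
    have h1 := hP r hr (hr.2.le.trans htT)
    have h2 := norm_exp_neg_I_smul_sub_one_le (H.kick_isHermitian t)
    have h3 := H.cumulativeStrength_add_norm_kick_le hT (hs.trans hr.1) hr.2 htT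
    have h4 : NormedSpace.exp (-(Complex.I • H.kick t)) * (U r : Matrix (Fin d) (Fin d) ℂ) - U s =
        (NormedSpace.exp (-(Complex.I • H.kick t)) - 1) * (U r : Matrix (Fin d) (Fin d) ℂ) +
          ((U r : Matrix (Fin d) (Fin d) ℂ) - U s) := by noncomm_ring
    rw [h4]
    refine (norm_add_le _ _).trans ?_
    rw [CStarRing.norm_mul_coe_unitary]
    linarith

/-- Floquet's theorem. -/
theorem map_add_period (hU : H.IsPropagator U) (hT : 0 < T) {t : ℝ} (ht : 0 ≤ t) :
    (U (t + T) : Matrix (Fin d) (Fin d) ℂ) = U t * U T := by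
  refine real_induction (P := fun t => (U (t + T) : Matrix (Fin d) (Fin d) ℂ) = U t * U T)
    (by simp [hU.initial]) ?_ ?_ t ht
  -- Just after `t`, the defect `U (r + T) - U r * U T` starts from `0` and solves the homogeneous
  -- equation. The interval is shortened until its regular strength is below `1 / 2`, which makes
  -- the integral operator a contraction.
  · intro t ht hP
    obtain ⟨t', ht', hk⟩ := H.exists_kick_eq_zero hT t
    have hcont : Continuous fun x => ∫ r in t..x, ‖H.reg r‖ :=
      intervalIntegral.continuous_primitive (H.intervalIntegrable_norm_reg hT) t
    have hsm : ∀ᶠ x in 𝓝[>] t, ∫ r in t..x, ‖H.reg r‖ < 1 / 2 :=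
      ((hcont.tendsto t).mono_left nhdsWithin_le_nhds).eventually
        (gt_mem_nhds (by simp))
    obtain ⟨b, hb, hbt⟩ := (hsm.and (Ioc_mem_nhdsGT ht')).exists
    refine ⟨b, hbt.1, fun r hr => ?_⟩
    refine sub_eq_zero.mp (eq_zero_of_eq_integral_mul (g := H.reg)
      (X := fun r => (U (r + T) : Matrix (Fin d) (Fin d) ℂ) - U r * U T) 
      (C := 2 * ‖(1 : Matrix (Fin d) (Fin d) ℂ)‖)
      (H.intervalIntegrable_norm_reg hT t b) hb.le ?_ ?_ r ⟨hr.1.le, hr.2⟩)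
    · intro x hx
      refine (_root_.norm_sub_le _ _).trans ?_
      -- The norm of `1` is kept as it is, since it is `0` when `d = 0`.
      have hn : ∀ V : Matrix.unitaryGroup (Fin d) ℂ, ‖(V : Matrix (Fin d) (Fin d) ℂ)‖ =
          ‖(1 : Matrix (Fin d) (Fin d) ℂ)‖ := fun V => by
        rw [← CStarRing.norm_mul_coe_unitary 1 V, one_mul]
      have h1 := hn (U (x + T))
      have h2 := hn (U x)
      rw [CStarRing.norm_mul_coe_unitary]
      linarith
    · intro x hx
      have h1 := hU.schrodinger t x ht hx.1 fun y hy =>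
        hk y ⟨hy.1, hy.2.trans (hx.2.trans hbt.2)⟩
      have h2 := hU.schrodinger (t + T) (x + T) (by linarith) (by linarith [hx.1]) fun y hy => by
        rw [← H.kick_periodic.sub_eq]
        exact hk _ ⟨by linarith [hy.1], by linarith [hy.2, hx.2, hbt.2]⟩
      have i1 := hU.integrable t x ht hx.1
      have i2 := hU.integrable (t + T) (x + T) (by linarith) (by linarith [hx.1])
      have i2' := i2.comp_add_right T
      simp only [add_sub_cancel_right, H.reg_periodic _] at i2'
      rw [← intervalIntegral.integral_comp_add_right (fun r => H.reg r *
        (U r : Matrix (Fin d) (Fin d) ℂ))] at h2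
      simp only [H.reg_periodic _] at h2
      have h3 : (∫ r in t..x, H.reg r * ((U (r + T) : Matrix (Fin d) (Fin d) ℂ) - U r * U T)) =
          (∫ r in t..x, H.reg r * (U (r + T) : Matrix (Fin d) (Fin d) ℂ)) -
          (∫ r in t..x, H.reg r * (U r : Matrix (Fin d) (Fin d) ℂ)) * U T := by
        have h5 := ((ContinuousLinearMap.mul ℝ (Matrix (Fin d) (Fin d) ℂ)).flip
          (U T : Matrix (Fin d) (Fin d) ℂ)).intervalIntegral_comp_comm i1
        simp only [ContinuousLinearMap.flip_apply, ContinuousLinearMap.mul_apply'] at h5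
        rw [← h5, ← intervalIntegral.integral_sub i2' (i1.mul_const _)]
        simp only [mul_sub, mul_assoc]
      have h4 : (U (x + T) : Matrix (Fin d) (Fin d) ℂ) - U x * U T = -(Complex.I •
          ∫ r in t..x, H.reg r * ((U (r + T) : Matrix (Fin d) (Fin d) ℂ) - U r * U T)) := by
        rw [h3, h2, h1, hP, sub_mul, smul_sub, smul_mul_assoc]
        abel
      rw [h4, norm_neg, norm_smul, Complex.norm_I, one_mul]
  -- By periodicity the same pulse acts at `t` and `t + T`, so both sides are the left limit of the
  -- same function.
  · intro t ht hP
    have h1 := (hU.pulse t ht).mul_const (U T : Matrix (Fin d) (Fin d) ℂ)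
    have hshift : Filter.Tendsto (fun r => r + T) (𝓝[<] t) (𝓝[<] (t + T)) := by
      refine tendsto_nhdsWithin_iff.mpr ⟨?_, ?_⟩
      · exact ((continuous_id.add continuous_const).tendsto t).mono_left nhdsWithin_le_nhds
      · filter_upwards [self_mem_nhdsWithin] with r hr
        simpa using hr
    have h2 := (hU.pulse (t + T) (by linarith)).comp hshift
    refine tendsto_nhds_unique h2 (h1.congr' ?_)
    filter_upwards [Ico_mem_nhdsLT ht] with r hr
    rw [Function.comp_apply, hP r hr, H.kick_periodic, mul_assoc]

end IsPropagator
end PeriodicHamiltonian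
end Propagator
-- Estimates of the net radius and of the constants.
section Numerics

/-- Each of the `k` factors `(n + j) / j` of the binomial coefficient is at most `n + 1`. Exchanging
`n` and `k` gives the second bound on `haarMoment`. -/
theorem factorial_add_le_pow_mul (n k : ℕ) :
    (n + k).factorial ≤ (n + 1) ^ k * (n.factorial * k.factorial) := by
  induction k with
  | zero => simp
  | succ k ih =>
    rw [← Nat.add_assoc, Nat.factorial_succ, Nat.factorial_succ k, pow_succ]
    calc (n + k + 1) * (n + k).factorial
        ≤ ((n + 1) * (k + 1)) * ((n + 1) ^ k * (n.factorial * k.factorial)) :=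
          Nat.mul_le_mul (by nlinarith) ih
      _ = _ := by ring

theorem factorial_mul_factorial_lt {n k : ℕ} (hn : 1 ≤ n) (hk : 1 ≤ k) :
    n.factorial * k.factorial < (n + k).factorial := by
  induction k, hk using Nat.le_induction with
  | base =>
    rw [Nat.factorial_one, mul_one, Nat.factorial_succ]
    nlinarith [n.factorial_pos]
  | succ k _ ih =>
    rw [← Nat.add_assoc, Nat.factorial_succ (n + k), Nat.factorial_succ k]
    nlinarith [(n + k).factorial_pos]

/-- The `k`-th moment of the transition probability between Haar random states of `ℂⁿ⁺¹`. -/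
noncomputable def haarMoment (n k : ℕ) : ℝ := (n.factorial * k.factorial : ℝ) / (n + k).factorial

theorem haarMoment_pos (n k : ℕ) : 0 < haarMoment n k := by
  unfold haarMoment; positivity

theorem haarMoment_lt_one {n k : ℕ} (hn : 1 ≤ n) (hk : 1 ≤ k) : haarMoment n k < 1 := by
  rw [haarMoment, div_lt_one (by positivity)]
  exact_mod_cast factorial_mul_factorial_lt hn hk

theorem inv_pow_le_haarMoment (n k : ℕ) : (((n : ℝ) + 1) ^ k)⁻¹ ≤ haarMoment n k := by
  rw [haarMoment, inv_le_comm₀ (by positivity) (by positivity), inv_div,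
    div_le_iff₀ (by positivity)]
  exact_mod_cast factorial_add_le_pow_mul n k

theorem inv_pow_le_haarMoment' (n k : ℕ) : (((k : ℝ) + 1) ^ n)⁻¹ ≤ haarMoment n k := by
  have := inv_pow_le_haarMoment k n
  rwa [haarMoment, add_comm k n, mul_comm] at this

theorem netRadius_succ (n k : ℕ) :
    netRadius k (n + 1) = √(1 - haarMoment n k ^ (1 / (k : ℝ))) := by
  rw [netRadius, haarMoment, Nat.add_sub_cancel, show n + 1 + k - 1 = n + k by omega]

theorem netRadius_sq {n k : ℕ} (hn : 1 ≤ n) (hk : 1 ≤ k) :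
    netRadius k (n + 1) ^ 2 = 1 - haarMoment n k ^ (1 / (k : ℝ)) := by
  rw [netRadius_succ, Real.sq_sqrt]
  rw [sub_nonneg]
  exact Real.rpow_le_one (haarMoment_pos n k).le (haarMoment_lt_one hn hk).le (by positivity)

theorem netRadius_pos {n k : ℕ} (hn : 1 ≤ n) (hk : 1 ≤ k) : 0 < netRadius k (n + 1) := by
  rw [netRadius_succ, Real.sqrt_pos, sub_pos]
  have : 0 < k := hk
  exact Real.rpow_lt_one (haarMoment_pos n k).le (haarMoment_lt_one hn hk) (by positivity)

/-- Keeps `γ` away from `1` uniformly in `k`, as needed when the orbit is so short that one point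
nearly suffices. -/
theorem netRadius_sq_le_one_sub {n k : ℕ} (hn : 1 ≤ n) (hk : 1 ≤ k) :
    netRadius k (n + 1) ^ 2 ≤ 1 - 1 / ((n : ℝ) + 1) := by
  rw [netRadius_sq hn hk]
  have h := Real.rpow_le_rpow (z := 1 / (k : ℝ)) (by positivity) (inv_pow_le_haarMoment n k)
    (by positivity)
  rw [Real.inv_rpow (by positivity), one_div (k : ℝ),
    Real.pow_rpow_inv_natCast (by positivity) (by omega)] at h
  rw [one_div, one_div]
  linarith

/-- Write the `k`-th root of the moment as `exp (log haarMoment / k)`, and use `exp x ≥ 1 + x` with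
`log haarMoment ≥ -n log (k + 1)`. -/
theorem netRadius_sq_le_div {n k : ℕ} (hn : 1 ≤ n) (hk : 1 ≤ k) :
    netRadius k (n + 1) ^ 2 ≤ n / (k / Real.log (k + 1)) := by
  have hk0 : (0 : ℝ) < k := by exact_mod_cast hk
  have h1 := Real.log_le_log (by positivity) (inv_pow_le_haarMoment' n k)
  rw [Real.log_inv, Real.log_pow] at h1
  have h2 := Real.add_one_le_exp (Real.log (haarMoment n k) * (1 / (k : ℝ)))
  rw [← Real.rpow_def_of_pos (haarMoment_pos n k)] at h2
  rw [netRadius_sq hn hk, div_div_eq_mul_div, le_div_iff₀ hk0]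
  have h3 : Real.log (haarMoment n k) * (1 / (k : ℝ)) * k = Real.log (haarMoment n k) := by
    field_simp
  nlinarith

theorem boundConst_succ {n : ℕ} (hn : 1 ≤ n) : boundConst (n + 1) =
    2 * (2 * (n : ℝ) - 1) ^ (2 * n - 1) / (16 ^ n * (n : ℝ) ^ (2 * n)) := by
  have hn0 : (0 : ℝ) < n := by exact_mod_cast hn
  have hm : (0 : ℝ) < 2 * (n : ℝ) - 1 := by
    have : (1 : ℝ) ≤ n := by exact_mod_cast hn
    linarith
  have e1 : (2 : ℝ) ^ (5 - 4 * ((n : ℝ) + 1)) = 2 / 16 ^ n := by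
    rw [show 5 - 4 * ((n : ℝ) + 1) = 1 - ((4 * n : ℕ) : ℝ) by push_cast; ring,
      Real.rpow_sub two_pos, Real.rpow_one, Real.rpow_natCast, pow_mul]
    norm_num
  have e2 : (n : ℝ) ^ (2 - 2 * ((n : ℝ) + 1)) = ((n : ℝ) ^ (2 * n))⁻¹ := by
    rw [show 2 - 2 * ((n : ℝ) + 1) = -((2 * n : ℕ) : ℝ) by push_cast; ring,
      Real.rpow_neg hn0.le, Real.rpow_natCast]
  have e3 : (2 * (n : ℝ) - 1) ^ (2 * ((n : ℝ) + 1) - 3) = (2 * (n : ℝ) - 1) ^ (2 * n - 1) := by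
    rw [← Real.rpow_natCast, Nat.cast_sub (by omega)]
    congr 1; push_cast; ring
  rw [boundConst]
  push_cast
  rw [show (n : ℝ) + 1 - 1 = n by ring, e1, e2,
    show (2 * ((n : ℝ) + 1) - 3) = 2 * (n : ℝ) - 1 by ring]
  rw [show (2 * (n : ℝ) - 1) ^ (2 * (n : ℝ) - 1) = (2 * (n : ℝ) - 1) ^ (2 * ((n : ℝ) + 1) - 3) by
    congr 1; ring, e3]
  field_simp

theorem netRadius_rpow {n : ℕ} (hn : 1 ≤ n) {γ : ℝ} (hγ : 0 < γ) :
    γ ^ (3 - 2 * ((n + 1 : ℕ) : ℝ)) = (γ ^ (2 * n - 1))⁻¹ := by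
  rw [← Real.rpow_natCast, ← Real.rpow_neg hγ.le, Nat.cast_sub (by omega)]
  congr 1; push_cast; ring

/-- The volume comparison behind the lower bound: a net of radius `γ + δ` with `⌊B / δ⌋ + 1` points
exists for all `δ` only if `B` is large. -/
theorem boundConst_mul_rpow_le_of_net {n : ℕ} (hn : 1 ≤ n) {γ B : ℝ} (hγ : 0 < γ) (hB : 0 ≤ B)
    (hγn : γ ^ 2 ≤ 1 - 1 / ((n : ℝ) + 1))
    (hnet : ∀ δ, 0 < δ → 1 ≤ ((⌊B / δ⌋₊ : ℝ) + 1) * (γ + δ) ^ (2 * n)) :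
    boundConst (n + 1) * γ ^ (3 - 2 * ((n + 1 : ℕ) : ℝ)) ≤ B := by
  rw [boundConst_succ hn, netRadius_rpow hn hγ]
  obtain ⟨p, rfl⟩ := Nat.exists_eq_add_of_le' hn
  have hp0 : (0 : ℝ) ≤ p := p.cast_nonneg
  have hexp : 2 * (p + 1) - 1 = 2 * p + 1 := by omega
  rw [hexp]
  set N : ℝ := ((p + 1 : ℕ) : ℝ) with hN
  have hN1 : 1 ≤ N := by rw [hN]; push_cast; linarith
  set m : ℝ := 2 * N - 1 with hm
  have hm0 : 0 < m := by linarith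
  rw [← div_eq_mul_inv, div_div, div_le_iff₀ (by positivity)]
  -- Both cases below in fact give a constant larger than `boundConst` by `4 ^ p`; this inequality
  -- discards the surplus.
  have h4 : (4 : ℝ) ≤ 4 ^ (p + 1) := by
    rw [pow_succ]; nlinarith [one_le_pow₀ (M₀ := ℝ) (a := 4) (n := p) (by norm_num)]
  have h16 : (16 : ℝ) ^ (p + 1) = 4 ^ (p + 1) * 4 ^ (p + 1) := by
    rw [← mul_pow]; norm_num
  -- The value `δ = γ / (2n - 1)` minimizes `(γ + δ) ^ (2 * n) / δ`.
  have hδ : 0 < γ / m := by positivity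
  have hsum : γ + γ / m = γ * (2 * N) / m := by
    field_simp; rw [hm]; ring
  have h2n : 2 * (p + 1) = (2 * p + 1) + 1 := by ring
  rcases lt_or_ge B (γ / m) with hlt | hge
  -- Here `⌊B / δ⌋ + 1` cannot be bounded by `2B / δ`. Instead, a `δ` strictly between `B` and `1 -
  -- γ` would give a one-point net of radius below `1`, so `B ≥ 1 - γ ≥ (1 - γ²) / 2`.
  · have h1 : 1 ≤ γ + B := by
      by_contra! hcon
      obtain ⟨δ, hδ1, hδ2⟩ := exists_between (show B < 1 - γ by linarith)
      have hδ0 : 0 < δ := hB.trans_lt hδ1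
      have h := hnet δ hδ0
      rw [Nat.floor_eq_zero.mpr ((div_lt_one hδ0).mpr hδ1), Nat.cast_zero, zero_add, one_mul] at h
      exact absurd h (not_le.mpr (pow_lt_one₀ (by linarith) (by linarith) (by omega)))
    have hγ1 : γ < 1 := by
      have : 0 < 1 / (N + 1) := by positivity
      nlinarith
    have hB2 : 1 / (2 * (N + 1)) ≤ B := by
      have : 1 / (2 * (N + 1)) = 1 / (N + 1) / 2 := by field_simp
      rw [this]
      nlinarith
    have hγm : m ≤ γ * (2 * N) := by
      have : 1 ≤ γ * (2 * N) / m := by rw [← hsum]; linarith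
      rwa [one_le_div hm0] at this
    have hpow : m ^ (2 * p + 1) ≤ γ ^ (2 * p + 1) * (2 * N) ^ (2 * p + 1) := by
      rw [← mul_pow]; exact pow_le_pow_left₀ hm0.le hγm _
    have h5 : (2 * N) ^ (2 * p + 1) * (2 * N) = 4 ^ (p + 1) * N ^ (2 * (p + 1)) := by
      rw [← pow_succ, ← h2n, mul_pow, pow_mul]; norm_num
    have h6 : 1 ≤ B * (2 * (N + 1)) := by
      rwa [div_le_iff₀ (by positivity)] at hB2
    calc 2 * m ^ (2 * p + 1) ≤ 2 * (γ ^ (2 * p + 1) * (2 * N) ^ (2 * p + 1)) := by linarith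
      _ ≤ (B * (2 * (N + 1))) * (2 * (γ ^ (2 * p + 1) * (2 * N) ^ (2 * p + 1))) :=
        le_mul_of_one_le_left (by positivity) h6
      _ ≤ (B * (4 * N)) * (2 * (γ ^ (2 * p + 1) * (2 * N) ^ (2 * p + 1))) := by
        gcongr ?_ * _
        gcongr B * ?_
        linarith
      _ = B * γ ^ (2 * p + 1) * 4 * ((2 * N) ^ (2 * p + 1) * (2 * N)) := by ring
      _ = 4 * (B * γ ^ (2 * p + 1) * (4 ^ (p + 1) * N ^ (2 * (p + 1)))) := by rw [h5]; ring
      _ ≤ 4 ^ (p + 1) * (B * γ ^ (2 * p + 1) * (4 ^ (p + 1) * N ^ (2 * (p + 1)))) := by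
        gcongr
      _ = _ := by rw [h16]; ring
  · have h := hnet _ hδ
    have h1 : 1 ≤ B / (γ / m) := (one_le_div hδ).mpr hge
    have h2 : (⌊B / (γ / m)⌋₊ : ℝ) + 1 ≤ 2 * (B / (γ / m)) := by
      linarith [Nat.floor_le (zero_le_one.trans h1)]
    rw [hsum] at h
    have h3 : 1 ≤ 2 * (B / (γ / m)) * (γ * (2 * N) / m) ^ (2 * (p + 1)) :=
      h.trans (mul_le_mul_of_nonneg_right h2 (by positivity))
    have h5 : 2 * (B / (γ / m)) * (γ * (2 * N) / m) ^ (2 * (p + 1)) =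
        2 * B * γ ^ (2 * p + 1) * (4 ^ (p + 1) * N ^ (2 * (p + 1))) / m ^ (2 * p + 1) := by
      have : (2 * N) ^ (2 * (p + 1)) = 4 ^ (p + 1) * N ^ (2 * (p + 1)) := by
        rw [mul_pow, pow_mul 2]; norm_num
      rw [← this, div_pow, mul_pow, h2n, pow_succ γ, pow_succ m]
      field_simp
    rw [h5, one_le_div (by positivity)] at h3
    calc 2 * m ^ (2 * p + 1)
        ≤ 2 * (2 * B * γ ^ (2 * p + 1) * (4 ^ (p + 1) * N ^ (2 * (p + 1)))) := by linarith
      _ = 4 * (B * γ ^ (2 * p + 1) * (4 ^ (p + 1) * N ^ (2 * (p + 1)))) := by ring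
      _ ≤ 4 ^ (p + 1) * (B * γ ^ (2 * p + 1) * (4 ^ (p + 1) * N ^ (2 * (p + 1)))) := by
        gcongr
      _ = _ := by rw [h16]; ring

/-- Uses `(n / (n + 1)) ^ (n + 1) ≤ e⁻¹` and `(2n / (2n - 1)) ^ (2n - 1) ≤ e`, whose constants
cancel. The remaining factor `2` is at most `√n` once `n ≥ 4`; smaller `n` are checked numerically,
with equality at `n = 1`. -/
theorem four_pow_mul_pow_le {n : ℕ} (hn : 1 ≤ n) :
    (4 : ℝ) ^ n * (n : ℝ) ^ (3 * n) ≤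
      (2 * (n : ℝ) - 1) ^ (2 * n - 1) * ((n : ℝ) + 1) ^ (n + 1) * √n := by
  rcases lt_or_ge n 4 with h4 | h4
  · interval_cases n
    · norm_num
    · have : (1.41 : ℝ) ≤ √2 := Real.le_sqrt_of_sq_le (by norm_num)
      norm_num at this ⊢
      linarith
    · have : (1.7 : ℝ) ≤ √3 := Real.le_sqrt_of_sq_le (by norm_num)
      norm_num at this ⊢
      linarith
  · obtain ⟨p, rfl⟩ := Nat.exists_eq_add_of_le' hn
    rw [show 2 * (p + 1) - 1 = 2 * p + 1 by omega]
    set N : ℝ := ((p + 1 : ℕ) : ℝ) with hN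
    have hN4 : (4 : ℝ) ≤ N := by rw [hN]; exact_mod_cast h4
    set m : ℝ := 2 * N - 1 with hm
    have hm0 : 0 < m := by linarith
    have hmp : m = ((2 * p + 1 : ℕ) : ℝ) := by rw [hm, hN]; push_cast; ring
    have h1 : N ^ (p + 1 + 1) ≤ Real.exp (-1) * (N + 1) ^ (p + 1 + 1) := by
      have h := Real.one_sub_le_exp_neg (1 / (N + 1))
      have h' : N ≤ Real.exp (-(1 / (N + 1))) * (N + 1) := by
        have : N = (1 - 1 / (N + 1)) * (N + 1) := by field_simp; ring
        calc N = (1 - 1 / (N + 1)) * (N + 1) := this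
          _ ≤ _ := by gcongr
      refine (pow_le_pow_left₀ (by linarith) h' _).trans (le_of_eq ?_)
      rw [mul_pow, ← Real.exp_nat_mul]
      congr 2
      rw [hN]; push_cast; field_simp
    have h2 : (2 * N) ^ (2 * p + 1) ≤ Real.exp 1 * m ^ (2 * p + 1) := by
      have h := Real.add_one_le_exp (1 / m)
      have h' : 2 * N ≤ Real.exp (1 / m) * m := by
        have : 2 * N = (1 / m + 1) * m := by field_simp; rw [hm]; ring
        calc 2 * N = (1 / m + 1) * m := this
          _ ≤ _ := by gcongr
      refine (pow_le_pow_left₀ (by linarith) h' _).trans (le_of_eq ?_)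
      rw [mul_pow, ← Real.exp_nat_mul, ← hmp]
      congr 2
      field_simp
    have h3 : (2 : ℝ) ≤ √N := Real.le_sqrt_of_sq_le (by linarith)
    have h5 : N ^ (p + 1 + 1) * (2 * N) ^ (2 * p + 1) ≤ m ^ (2 * p + 1) * (N + 1) ^ (p + 1 + 1) := by
      refine (mul_le_mul h1 h2 (by positivity) (by positivity)).trans (le_of_eq ?_)
      have : Real.exp (-1) * Real.exp 1 = 1 := by rw [← Real.exp_add]; simp
      linear_combination (m ^ (2 * p + 1) * (N + 1) ^ (p + 1 + 1)) * this
    calc (4 : ℝ) ^ (p + 1) * N ^ (3 * (p + 1))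
        = N ^ (p + 1 + 1) * (2 * N) ^ (2 * p + 1) * 2 := by
          rw [mul_pow, show (4 : ℝ) = 2 ^ 2 by norm_num, ← pow_mul]; ring
      _ ≤ _ := by gcongr

theorem div_mul_rpow_le_boundConst_mul_rpow {n k : ℕ} (hn : 1 ≤ n) (hk : 1 ≤ k) :
    8 / (4 * ((n + 1 : ℕ) : ℝ)) ^ (n + 1) *
        ((k : ℝ) / Real.log ((k : ℝ) + 1)) ^ (((n + 1 : ℕ) : ℝ) - 3 / 2) ≤
      boundConst (n + 1) * netRadius k (n + 1) ^ (3 - 2 * ((n + 1 : ℕ) : ℝ)) := by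
  have hn0 : (0 : ℝ) < n := by exact_mod_cast hn
  have hn1 : (1 : ℝ) ≤ n := by exact_mod_cast hn
  have hm : (0 : ℝ) < 2 * (n : ℝ) - 1 := by linarith
  have hk0 : (0 : ℝ) < k := by exact_mod_cast hk
  have hlog : 0 < Real.log ((k : ℝ) + 1) := Real.log_pos (by linarith)
  set y : ℝ := (k : ℝ) / Real.log ((k : ℝ) + 1) with hy
  have hy0 : 0 < y := by positivity
  have hγ := netRadius_pos hn hk
  set γ := netRadius k (n + 1) with hγdef
  have he : 0 ≤ ((n + 1 : ℕ) : ℝ) - 3 / 2 := by push_cast; linarith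
  have h1 : (y / n) ^ (((n + 1 : ℕ) : ℝ) - 3 / 2) ≤ γ ^ (3 - 2 * ((n + 1 : ℕ) : ℝ)) := by
    have : γ ^ (3 - 2 * ((n + 1 : ℕ) : ℝ)) = ((γ ^ 2)⁻¹) ^ (((n + 1 : ℕ) : ℝ) - 3 / 2) := by
      rw [Real.inv_rpow (by positivity), ← Real.rpow_neg (by positivity), ← Real.rpow_natCast,
        ← Real.rpow_mul hγ.le]
      congr 1; push_cast; ring
    rw [this]
    refine Real.rpow_le_rpow (by positivity) ?_ he
    rw [← inv_div]
    exact inv_anti₀ (by positivity) (netRadius_sq_le_div hn hk)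
  have hC : 0 < boundConst (n + 1) := by rw [boundConst_succ hn]; positivity
  refine le_trans ?_ (mul_le_mul_of_nonneg_left h1 hC.le)
  rw [Real.div_rpow hy0.le hn0.le, ← mul_div_assoc, mul_div_right_comm]
  refine mul_le_mul_of_nonneg_right ?_ (by positivity)
  have h2 : (n : ℝ) ^ (((n + 1 : ℕ) : ℝ) - 3 / 2) = (n : ℝ) ^ n / √n := by
    rw [show ((n + 1 : ℕ) : ℝ) - 3 / 2 = (n : ℝ) - 1 / 2 by push_cast; ring, Real.rpow_sub hn0,
      Real.rpow_natCast, Real.sqrt_eq_rpow]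
  have h3 := four_pow_mul_pow_le hn
  rw [h2, boundConst_succ hn, div_div_eq_mul_div, div_mul_eq_mul_div, div_div,
    div_le_div_iff₀ (by positivity) (by positivity)]
  push_cast
  have h16 : (16 : ℝ) ^ n = 4 ^ n * 4 ^ n := by rw [← mul_pow]; norm_num
  calc 8 * ((16 : ℝ) ^ n * (n : ℝ) ^ (2 * n) * (n : ℝ) ^ n)
      = 8 * 4 ^ n * (4 ^ n * (n : ℝ) ^ (3 * n)) := by rw [h16]; ring
    _ ≤ 8 * 4 ^ n * ((2 * (n : ℝ) - 1) ^ (2 * n - 1) * ((n : ℝ) + 1) ^ (n + 1) * √n) := by gcongr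
    _ = _ := by rw [mul_pow, pow_succ 4 n]; ring

theorem tendsto_div_log_atTop :
    Filter.Tendsto (fun k : ℕ => (k : ℝ) / Real.log ((k : ℝ) + 1)) Filter.atTop Filter.atTop := by
  have h := (Real.tendsto_pow_log_div_mul_add_atTop 1 (-1) 1 one_ne_zero).comp
    (Filter.tendsto_atTop_add_const_right _ 1 (tendsto_natCast_atTop_atTop (R := ℝ)))
  have h' : Filter.Tendsto (fun k : ℕ => Real.log ((k : ℝ) + 1) / k) Filter.atTop (𝓝[>] 0) := by
    refine tendsto_nhdsWithin_iff.mpr ⟨?_, ?_⟩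
    · simpa [Function.comp_def] using h
    · filter_upwards [Filter.eventually_ge_atTop 1] with k hk
      have hk0 : (0 : ℝ) < k := by exact_mod_cast hk
      exact div_pos (Real.log_pos (by linarith)) hk0
  exact h'.inv_tendsto_nhdsGT_zero.congr fun k => by simp

/-- The lower bounds on the strength are unbounded in `k`. -/
theorem exists_lt_boundConst_mul_rpow {n : ℕ} (hn : 1 ≤ n) (B : ℝ) : ∃ k : ℕ, 1 ≤ k ∧
    B < boundConst (n + 1) * netRadius k (n + 1) ^ (3 - 2 * ((n + 1 : ℕ) : ℝ)) := by
  have hn1 : (1 : ℝ) ≤ n := by exact_mod_cast hn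
  have h1 : Filter.Tendsto (fun k : ℕ => 8 / (4 * ((n + 1 : ℕ) : ℝ)) ^ (n + 1) *
      ((k : ℝ) / Real.log ((k : ℝ) + 1)) ^ (((n + 1 : ℕ) : ℝ) - 3 / 2)) Filter.atTop Filter.atTop :=
    Filter.Tendsto.const_mul_atTop (by positivity)
      ((tendsto_rpow_atTop (by push_cast; linarith)).comp tendsto_div_log_atTop)
  obtain ⟨k, hk, hk1⟩ := ((h1.eventually_gt_atTop B).and (Filter.eventually_ge_atTop 1)).exists
  exact ⟨k, hk1, hk.trans_le (div_mul_rpow_le_boundConst_mul_rpow hn hk1)⟩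

end Numerics
-- The closed orbit as a net in trace distance.
section Net

/-- Pythagoras for the projection of `φ` onto the line of `w`. The trace distance is thus the
distance from `φ` to that line, which reduces its triangle inequality to the one for norms. -/
theorem norm_sub_smul_sq {E : Type*} [NormedAddCommGroup E] [InnerProductSpace ℂ E]
    {w φ : E} (hw : ‖w‖ = 1) (hφ : ‖φ‖ = 1) (c : ℂ) :
    ‖φ - c • w‖ ^ 2 = 1 - ‖(inner ℂ w φ : ℂ)‖ ^ 2 + ‖inner ℂ w φ - c‖ ^ 2 := by
  set a : ℂ := inner ℂ w φ with ha
  have h1 : inner ℂ w (φ - a • w) = 0 := by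
    rw [inner_sub_right, inner_smul_right, inner_self_eq_norm_sq_to_K, hw, ← ha]
    simp
  have h2 : φ - c • w = (φ - a • w) + (a - c) • w := by module
  have h3 : φ = (φ - a • w) + a • w := by module
  have h4 : ∀ b : ℂ, ‖(φ - a • w) + b • w‖ ^ 2 = ‖φ - a • w‖ ^ 2 + ‖b‖ ^ 2 := fun b => by
    have h5 : inner ℂ (φ - a • w) (b • w) = 0 := by
      rw [inner_smul_right, ← inner_conj_symm, h1]; simp
    have := norm_add_sq_eq_norm_sq_add_norm_sq_of_inner_eq_zero _ _ h5
    rw [norm_smul, hw, mul_one] at this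
    simpa only [sq] using this
  have h6 := h4 a
  rw [← h3, hφ] at h6
  rw [h2, h4]
  linarith

/-- Triangle inequality for the trace distance. -/
theorem one_sub_sq_le_of_norm_sub_le {E : Type*} [NormedAddCommGroup E] [InnerProductSpace ℂ E]
    {w w' φ : E} (hw : ‖w‖ = 1) (hw' : ‖w'‖ = 1) (hφ : ‖φ‖ = 1) {ρ δ : ℝ} (hρ : 0 ≤ ρ)
    (hδ : ‖w - w'‖ ≤ δ) (h : 1 - ρ ^ 2 ≤ ‖(inner ℂ w φ : ℂ)‖ ^ 2) :
    1 - (ρ + δ) ^ 2 ≤ ‖(inner ℂ w' φ : ℂ)‖ ^ 2 := by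
  set c : ℂ := inner ℂ w φ with hc
  have h1 : ‖φ - c • w‖ ≤ ρ := by
    refine (sq_le_sq₀ (norm_nonneg _) hρ).mp ?_
    rw [norm_sub_smul_sq hw hφ, ← hc, sub_self, norm_zero]
    linarith
  have hc1 : ‖c‖ ≤ 1 := by
    simpa [hw, hφ] using norm_inner_le_norm (𝕜 := ℂ) w φ
  have h2 : ‖φ - c • w'‖ ≤ ρ + δ := by
    have : φ - c • w' = (φ - c • w) + c • (w - w') := by module
    rw [this]
    refine (norm_add_le _ _).trans (add_le_add h1 ?_)
    rw [norm_smul]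
    exact (mul_le_of_le_one_left (norm_nonneg _) hc1).trans hδ
  have h3 := norm_sub_smul_sq hw' hφ c
  have h4 := pow_le_pow_left₀ (norm_nonneg _) h2 2
  linarith [sq_nonneg ‖inner ℂ w' φ - c‖]

/-- If every probability were below `1 - (γ + ε)²`, so would be the `k`-th root of the Haar moment,
which is `1 - γ²`. The slack `ε` is there because the supremum over time need not be attained. -/
theorem OrbitMomentBound.exists_time {n k : ℕ} (hn : 1 ≤ n) (hk : 1 ≤ k)
    {U : ℝ → Matrix.unitaryGroup (Fin (n + 1)) ℂ} (h : OrbitMomentBound U k)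
    {φ ψ : EuclideanSpace ℂ (Fin (n + 1))} (hφ : ‖φ‖ = 1) (hψ : ‖ψ‖ = 1) {ε : ℝ} (hε : 0 < ε) :
    ∃ t, 0 ≤ t ∧ 1 - (netRadius k (n + 1) + ε) ^ 2 ≤
      ‖amplitude φ (U t : Matrix (Fin (n + 1)) (Fin (n + 1)) ℂ) ψ‖ ^ 2 := by
  by_contra! hcon
  set q := 1 - (netRadius k (n + 1) + ε) ^ 2 with hq
  have hq0 : 0 ≤ q := (sq_nonneg _).trans (hcon 0 le_rfl).le
  have h1 := h φ ψ hφ hψ (q ^ k) (by positivity) fun t ht => by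
    rw [pow_mul]; exact pow_le_pow_left₀ (sq_nonneg _) (hcon t ht).le k
  have h2 : haarMoment n k ≤ q ^ k := by
    rw [haarMoment]
    rwa [Nat.add_sub_cancel, show n + 1 + k - 1 = n + k by omega] at h1
  have h3 := Real.rpow_le_rpow (z := 1 / (k : ℝ)) (haarMoment_pos n k).le h2 (by positivity)
  rw [one_div, Real.pow_rpow_inv_natCast hq0 (by omega), ← one_div] at h3
  have h4 := netRadius_sq hn hk
  have h5 := netRadius_pos hn hk
  nlinarith

theorem exists_eigenvector_unitaryGroup {n : ℕ} (V : Matrix.unitaryGroup (Fin (n + 1)) ℂ) :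
    ∃ (ψ : EuclideanSpace ℂ (Fin (n + 1))) (c : ℂ), ‖ψ‖ = 1 ∧ ‖c‖ = 1 ∧
      Matrix.toEuclideanCLM (n := Fin (n + 1)) (𝕜 := ℂ) V ψ = c • ψ := by
  obtain ⟨c, hc⟩ := Module.End.exists_eigenvalue
    (Matrix.toEuclideanCLM (n := Fin (n + 1)) (𝕜 := ℂ)
      (V : Matrix (Fin (n + 1)) (Fin (n + 1)) ℂ)).toLinearMap
  obtain ⟨v, hv⟩ := hc.exists_hasEigenvector
  have hv0 : ‖v‖ ≠ 0 := norm_ne_zero_iff.mpr hv.2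
  have hψ : ‖((‖v‖⁻¹ : ℝ) : ℂ) • v‖ = 1 := by
    rw [norm_smul, Complex.norm_real, norm_inv, norm_norm, inv_mul_cancel₀ hv0]
  have heig : Matrix.toEuclideanCLM (n := Fin (n + 1)) (𝕜 := ℂ) V (((‖v‖⁻¹ : ℝ) : ℂ) • v) =
      c • ((‖v‖⁻¹ : ℝ) : ℂ) • v := by
    rw [map_smul, smul_comm c]
    congr 1
    exact hv.apply_eq_smul
  refine ⟨_, c, hψ, ?_, heig⟩
  have h := congrArg norm heig
  rwa [norm_toEuclideanCLM_apply_of_unitary, norm_smul c, hψ, mul_one, eq_comm] at h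

namespace PeriodicHamiltonian.IsPropagator

variable {d : ℕ} {T : ℝ} {H : PeriodicHamiltonian d T}
  {U : ℝ → Matrix.unitaryGroup (Fin d) ℂ}

/-- The orbit of an eigenstate of the Floquet operator is closed. -/
theorem exists_mem_period_norm_amplitude_eq (hU : H.IsPropagator U) (hT : 0 < T)
    {ψ : EuclideanSpace ℂ (Fin d)} {c : ℂ} (hc : ‖c‖ = 1)
    (hψ : Matrix.toEuclideanCLM (n := Fin d) (𝕜 := ℂ) (U T : Matrix (Fin d) (Fin d) ℂ) ψ = c • ψ)
    {t : ℝ} (ht : 0 ≤ t) : ∃ s ∈ Set.Icc 0 T, ∀ φ,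
      ‖amplitude φ (U t : Matrix (Fin d) (Fin d) ℂ) ψ‖ =
        ‖amplitude φ (U s : Matrix (Fin d) (Fin d) ℂ) ψ‖ := by
  have hstep : ∀ s, 0 ≤ s → ∀ φ, ‖amplitude φ (U (s + T) : Matrix (Fin d) (Fin d) ℂ) ψ‖ =
      ‖amplitude φ (U s : Matrix (Fin d) (Fin d) ℂ) ψ‖ := fun s hs φ => by
    rw [hU.map_add_period hT hs, amplitude, map_mul, ContinuousLinearMap.mul_def,
      ContinuousLinearMap.comp_apply, hψ,
      map_smul, inner_smul_right, norm_mul, hc, one_mul, amplitude]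
  have hmul : ∀ (m : ℕ) s, 0 ≤ s → ∀ φ,
      ‖amplitude φ (U (s + m * T) : Matrix (Fin d) (Fin d) ℂ) ψ‖ =
      ‖amplitude φ (U s : Matrix (Fin d) (Fin d) ℂ) ψ‖ := by
    intro m
    induction m with
    | zero => simp
    | succ m ih =>
      intro s hs φ
      rw [show s + ((m + 1 : ℕ) : ℝ) * T = s + m * T + T by push_cast; ring,
        hstep _ (by positivity), ih s hs]
  have h1 : (⌊t / T⌋₊ : ℝ) * T ≤ t := by
    rw [← le_div_iff₀ hT]; exact Nat.floor_le (by positivity)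
  have h2 : t < (⌊t / T⌋₊ + 1 : ℝ) * T := by
    rw [← div_lt_iff₀ hT]; exact Nat.lt_floor_add_one _
  refine ⟨t - ⌊t / T⌋₊ * T, ⟨by linarith, by linarith⟩, fun φ => ?_⟩
  rw [← hmul ⌊t / T⌋₊ (t - ⌊t / T⌋₊ * T) (by linarith), sub_add_cancel]

theorem norm_apply_sub_apply_le (hU : H.IsPropagator U) (hT : 0 < T)
    {ψ : EuclideanSpace ℂ (Fin d)} (hψ : ‖ψ‖ = 1) {s t : ℝ} (hs : s ∈ Set.Icc 0 T)
    (ht : t ∈ Set.Icc 0 T) :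
    ‖Matrix.toEuclideanCLM (n := Fin d) (𝕜 := ℂ) (U t : Matrix (Fin d) (Fin d) ℂ) ψ -
      Matrix.toEuclideanCLM (n := Fin d) (𝕜 := ℂ) (U s : Matrix (Fin d) (Fin d) ℂ) ψ‖ ≤
      |H.cumulativeStrength t - H.cumulativeStrength s| := by
  wlog hst : s ≤ t generalizing s t
  · rw [norm_sub_rev, abs_sub_comm]
    exact this ht hs (le_of_not_ge hst)
  have h1 := hU.norm_sub_le hT hs.1 hst ht.2
  rw [← sub_apply, ← map_sub]
  refine (ContinuousLinearMap.le_opNorm _ _).trans ?_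
  rw [hψ, mul_one]
  exact h1.trans (le_abs_self _)

end PeriodicHamiltonian.IsPropagator

/-- Finitely many points of a closed orbit of length `B` form a net. -/
theorem OrbitMomentBound.one_le_floor_mul_pow {n k : ℕ} (hn : 1 ≤ n) (hk : 1 ≤ k) {T : ℝ}
    (hT : 0 < T) {H : PeriodicHamiltonian (n + 1) T}
    {U : ℝ → Matrix.unitaryGroup (Fin (n + 1)) ℂ} (hU : H.IsPropagator U)
    (h : OrbitMomentBound U k) {δ : ℝ} (hδ : 0 < δ) :
    1 ≤ ((⌊H.strength / δ⌋₊ : ℝ) + 1) * (netRadius k (n + 1) + δ) ^ (2 * n) := by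
  obtain ⟨ψ, c, hψ, hc, heig⟩ := exists_eigenvector_unitaryGroup (U T)
  set cell : ℝ → ℕ := fun t => ⌊H.cumulativeStrength t / δ⌋₊ with hcell
  -- One representative time per strength cell. A pulse may jump over cells; those stay empty and
  -- receive the dummy time `0`.
  have hchoice : ∀ j : ℕ, ∃ t ∈ Set.Icc 0 T, ∀ s ∈ Set.Icc 0 T, cell s = j → cell t = j := by
    intro j
    by_cases hj : ∃ s ∈ Set.Icc 0 T, cell s = j
    · obtain ⟨s, hs, hsj⟩ := hj
      exact ⟨s, hs, fun _ _ _ => hsj⟩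
    · exact ⟨0, ⟨le_rfl, hT.le⟩, fun s hs hsj => (hj ⟨s, hs, hsj⟩).elim⟩
  choose τ hτ hτcell using hchoice
  set w : ℕ → EuclideanSpace ℂ (Fin (n + 1)) := fun j =>
    Matrix.toEuclideanCLM (n := Fin (n + 1)) (𝕜 := ℂ) (U (τ j)) ψ with hw
  have hw1 : ∀ t, ‖Matrix.toEuclideanCLM (n := Fin (n + 1)) (𝕜 := ℂ) (U t) ψ‖ = 1 := fun t => by
    rw [norm_toEuclideanCLM_apply_of_unitary, hψ]
  have hγ := netRadius_pos hn hk
  -- Two times in the same cell differ in strength by at most `δ`, so replacing the orbit point near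
  -- `φ` by its representative costs `δ`. Afterwards `ε → 0` with the number of cells fixed.
  have key : ∀ ε : ℝ, 0 < ε →
      1 ≤ ((⌊H.strength / δ⌋₊ : ℝ) + 1) * (netRadius k (n + 1) + ε + δ) ^ (2 * n) := by
    intro ε hε
    have := one_le_card_mul_pow_of_net (Finset.range (⌊H.strength / δ⌋₊ + 1)) w
      (fun j _ => hw1 _) (r := netRadius k (n + 1) + ε + δ) (by positivity) ?_
    · simpa using this
    intro φ hφ
    obtain ⟨t, ht, hamp⟩ := h.exists_time hn hk hφ hψ hε
    obtain ⟨s, hs, hts⟩ := hU.exists_mem_period_norm_amplitude_eq hT hc heig ht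
    refine ⟨cell s, ?_, ?_⟩
    · rw [Finset.mem_range, Nat.lt_succ_iff, ← H.cumulativeStrength_period]
      exact Nat.floor_le_floor (div_le_div_of_nonneg_right
        (H.cumulativeStrength_mono hT hs.2) hδ.le)
    · refine one_sub_sq_le_of_norm_sub_le (hw1 s) (hw1 _) hφ (by positivity) ?_ ?_
      · refine (hU.norm_apply_sub_apply_le hT hψ (hτ _) hs).trans ?_
        have h1 := hτcell (cell s) s hs rfl
        have h2 := Nat.floor_le (div_nonneg (H.cumulativeStrength_nonneg hs.1) hδ.le)
        have h3 := Nat.lt_floor_add_one (H.cumulativeStrength s / δ)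
        have h4 := Nat.floor_le (div_nonneg (H.cumulativeStrength_nonneg (hτ (cell s)).1) hδ.le)
        have h5 := Nat.lt_floor_add_one (H.cumulativeStrength (τ (cell s)) / δ)
        have h6 : (⌊H.cumulativeStrength (τ (cell s)) / δ⌋₊ : ℝ) =
          ⌊H.cumulativeStrength s / δ⌋₊ := by exact_mod_cast h1
        have h7 : |H.cumulativeStrength s / δ - H.cumulativeStrength (τ (cell s)) / δ| ≤ 1 := by
          rw [abs_le]; constructor <;> linarith
        rwa [← sub_div, abs_div, abs_of_pos hδ, div_le_one hδ] at h7
      · rw [hts, amplitude, norm_inner_symm] at hamp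
        exact hamp
  have hcont : Filter.Tendsto (fun ε : ℝ => ((⌊H.strength / δ⌋₊ : ℝ) + 1) *
      (netRadius k (n + 1) + ε + δ) ^ (2 * n)) (𝓝[>] 0)
      (𝓝 (((⌊H.strength / δ⌋₊ : ℝ) + 1) * (netRadius k (n + 1) + 0 + δ) ^ (2 * n))) :=
    Filter.Tendsto.mono_left (Continuous.tendsto (by fun_prop) 0) nhdsWithin_le_nhds
  rw [add_zero] at hcont
  exact ge_of_tendsto hcont (by filter_upwards [self_mem_nhdsWithin] with ε hε using key ε hε)

theorem OrbitMomentBound.boundConst_mul_rpow_le_strength {n k : ℕ} (hn : 1 ≤ n) (hk : 1 ≤ k)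
    {T : ℝ} (hT : 0 < T) {H : PeriodicHamiltonian (n + 1) T}
    {U : ℝ → Matrix.unitaryGroup (Fin (n + 1)) ℂ} (hU : H.IsPropagator U)
    (h : OrbitMomentBound U k) :
    boundConst (n + 1) * netRadius k (n + 1) ^ (3 - 2 * ((n + 1 : ℕ) : ℝ)) ≤ H.strength :=
  boundConst_mul_rpow_le_of_net hn (netRadius_pos hn hk)
    (H.cumulativeStrength_period ▸ H.cumulativeStrength_nonneg hT.le)
    (netRadius_sq_le_one_sub hn hk) fun _ hδ => h.one_le_floor_mul_pow hn hk hT hU hδ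

end Net
end HilbertErgodicity

open HilbertErgodicity in
theorem propositionD2 (d : ℕ) (hd : 2 ≤ d) (T : ℝ) (hT : 0 < T) (H : PeriodicHamiltonian d T)
    (U : ℝ → Matrix.unitaryGroup (Fin d) ℂ) (hU : H.IsPropagator U) :
    (∀ k : ℕ, 1 ≤ k →
      (IsHSE U k → boundConst d * netRadius k d ^ (3 - 2 * (d : ℝ)) ≤ H.strength) ∧
      8 / (4 * (d : ℝ)) ^ d * ((k : ℝ) / Real.log ((k : ℝ) + 1)) ^ ((d : ℝ) - 3 / 2) ≤
        boundConst d * netRadius k d ^ (3 - 2 * (d : ℝ))) ∧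
    ¬ IsCHSE U ∧ ¬ IsCUE U := by
  obtain ⟨n, rfl⟩ := Nat.exists_eq_add_of_le' (show 1 ≤ d by omega)
  have hn : 1 ≤ n := by omega
  obtain ⟨k, hk, hlt⟩ := exists_lt_boundConst_mul_rpow hn H.strength
  refine ⟨fun k hk => ⟨fun h => ?_, div_mul_rpow_le_boundConst_mul_rpow hn hk⟩, fun h => ?_,
    fun h => ?_⟩
  · exact (h.orbitMomentBound (by omega) hk).boundConst_mul_rpow_le_strength hn hk hT hU
  · exact hlt.not_ge
      (((h k hk).orbitMomentBound (by omega) hk).boundConst_mul_rpow_le_strength hn hk hT hU)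
  · exact hlt.not_ge
      (((h k hk).orbitMomentBound (by omega) hk).boundConst_mul_rpow_le_strength hn hk hT hU)
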